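/- Let $N \geq 1$ be an integer and let $B=(b_{ij})$ be an $N\times N$ doubly stochastic matrix, that is, a real matrix with $b_{ij}\geq 0$ for all $i,j$, $\sum_{j=1}^N b_{ij}=1$ for every $i$ and $\sum_{i=1}^N b_{ij}=1$ for every $j$. Let $$s_i=\max_{j=1,\ldots,N} b_{ij}\quad\text{for } i=1,\ldots,N,$$ and suppose that $\sum_{i=1}^N s_i\leq\gamma$ for some real number $\gamma\geq 1$. Let $\operatorname{per} B=\sum_{\sigma\in S_N}\prod_{i=1}^N b_{i\sigma(i)}$ denote the permanent of $B$ and let $\Gamma$ denote the Gamma function. Then $$\frac{N!}{N^N}\;\leq\;\operatorname{per} B\;\leq\;\left(\frac{\gamma}{N}\right)^{N}\left(\Gamma\!\left(1+\frac{N}{\gamma}\right)\right)^{\gamma}\;\leq\;\frac{N!}{N^N}\,(2\pi N)^{\gamma/2}\,e^{\gamma^2/(12N)}.$$ -/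

import Mathlib

/-! The lower bound is van der Waerden's, by Gurvits' method. The permanent is the coefficient of
x_1⋯x_N in the product of the row forms ∑_j b_ij x_j. If B has positive entries, this product has no
zero when all real parts are nonnegative and one is positive, and weighted AM–GM makes it at least ∏
x_j on positive vectors. Extracting the linear coefficient in one variable after another keeps both
properties up to a constant factor in the second, and these factors multiply to N!/N^N
(`IsHalfPlaneStable.le_coeff_ones`). Continuity removes the positivity assumption.

For the upper bound write L(x) = log Γ(x+1). Bregman–Minc (`card_perfectMatchings_le`) bounds the
permanent of a 0-1 matrix with row sums r_i by ∏ φ(r_i), where φ(x) = exp(L(x)/x). The analytic core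
is that φ is concave on [1,∞) (`logFac.concaveOn_exp_div`); as the permanent is linear in each row,
the bound then extends to entries in [0,1] and row sums at least 1. Applied to b_ij/s_i, whose row
sums are 1/s_i, it gives per B ≤ ∏ s_i φ(1/s_i). The logarithm of the right side is ∑ s_i H(1/s_i)
with H(x) = L(x) − x log x. Since H is concave and ∑ s_i ≤ γ, Jensen bounds this by γ H(N/γ), the
logarithm of the middle term (`logFac.sum_mul_le`).

The last inequality is Stirling's upper bound for L at N/γ, together with e^(−N) ≤ N!/N^N. -/

/-! ### Univariate polynomials with roots in the left half-plane. -/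

open Polynomial in
theorem Polynomial.coeff_one_ne_zero_of_roots_re_neg {R : ℂ[X]} (hdeg : 0 < R.natDegree)
    (h : ∀ t : ℂ, 0 ≤ t.re → R.eval t ≠ 0) : R.coeff 1 ≠ 0 := by
  intro h1
  have hd : 0 < R.degree := natDegree_pos_iff_degree_pos.mp hdeg
  have hR' : derivative R ≠ 0 := by
    intro h0
    have := derivative_eq_zero.mp h0
    omega
  -- A vanishing linear coefficient makes 0 a critical point, which Gauss–Lucas places in the convex
  -- hull of the roots, hence in the open left half-plane.
  have h0 : (0 : ℂ) ∈ (derivative R).rootSet ℂ := by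
    rw [mem_rootSet]
    refine ⟨hR', ?_⟩
    simp [← coeff_zero_eq_eval_zero, coeff_derivative, h1]
  have h2 := rootSet_derivative_subset_convexHull_rootSet hd h0
  have h3 : convexHull ℝ (R.rootSet ℂ) ⊆ {z : ℂ | z.re < 0} := by
    refine convexHull_min ?_ (convex_halfSpace_re_lt 0)
    intro z hz
    rw [mem_rootSet] at hz
    by_contra hc
    exact h z (not_lt.mp hc) (by simpa using hz.2)
  simpa using h3 h2

theorem Finset.prod_one_add_le_pow {ι : Type*} [Fintype ι] [Nonempty ι] {a : ι → ℝ}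
    (ha : ∀ i, 0 ≤ a i) :
    ∏ i, (1 + a i) ≤ (1 + (∑ i, a i) / Fintype.card ι) ^ Fintype.card ι := by
  have hc : (0 : ℝ) < Fintype.card ι := by exact_mod_cast Fintype.card_pos
  have := Real.geom_mean_le_arith_mean_weighted (Finset.univ : Finset ι)
    (fun _ => (Fintype.card ι : ℝ)⁻¹) (fun i => 1 + a i) (fun _ _ => by positivity)
    (by simp [hc.ne']) (fun i _ => by linarith [ha i])
  have h2 : ∑ i, (Fintype.card ι : ℝ)⁻¹ * (1 + a i) = 1 + (∑ i, a i) / Fintype.card ι := by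
    rw [← Finset.mul_sum, Finset.sum_add_distrib]
    simp
    field_simp
  rw [h2] at this
  calc ∏ i, (1 + a i) = (∏ i, (1 + a i) ^ (Fintype.card ι : ℝ)⁻¹) ^ Fintype.card ι := by
        rw [← Finset.prod_pow]
        refine Finset.prod_congr rfl fun i _ => ?_
        rw [Real.rpow_inv_natCast_pow (by linarith [ha i]) Fintype.card_ne_zero]
    _ ≤ _ := by
        gcongr
        exact Finset.prod_nonneg fun i _ => Real.rpow_nonneg (by linarith [ha i]) _

open Polynomial in
theorem Polynomial.coeff_prod_one_add_C_mul_X {ι : Type*} (s : Finset ι) (a : ι → ℝ) :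
    (∏ i ∈ s, (1 + C (a i) * X)).coeff 0 = 1 ∧
      (∏ i ∈ s, (1 + C (a i) * X)).coeff 1 = ∑ i ∈ s, a i := by
  classical
  induction s using Finset.induction_on with
  | empty => simp [coeff_one]
  | insert i s hi ih =>
    rw [Finset.prod_insert hi, Finset.sum_insert hi, mul_coeff_zero, mul_coeff_one, ih.1, ih.2]
    simp [coeff_one]
    ring

-- Real negative roots give R = K ∏ (1 + a_i t) with a_i > 0, so the linear coefficient is K S with
-- S = ∑ a_i. AM–GM yields c t ≤ K (1 + tS/(d+1))^(d+1), and the claim follows by optimising over t.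
open Polynomial in
theorem Polynomial.le_coeff_one_of_roots_neg {R : ℝ[X]} {d : ℕ} (hdeg : R.natDegree = d + 1)
    (hroots : ∀ w : ℂ, aeval w R = 0 → w.im = 0 ∧ w.re < 0) {c : ℝ}
    (hc : ∀ t : ℝ, 0 < t → c * t ≤ R.eval t) (hc0 : 0 < c) :
    ((d : ℝ) / (d + 1)) ^ d * c ≤ R.coeff 1 := by
  have hR0 : R ≠ 0 := by rintro rfl; simp at hdeg
  have hspl : R.Splits := by
    refine Splits.of_splits_map (algebraMap ℝ ℂ) (IsAlgClosed.splits _) fun w hw => ?_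
    rw [mem_roots (map_ne_zero hR0), IsRoot.def, eval_map_algebraMap] at hw
    exact ⟨w.re, Complex.ext (by simp) (by simp [(hroots w hw).1])⟩
  obtain ⟨l, hl⟩ : ∃ l : List ℝ, R.roots = l := ⟨_, (Multiset.coe_toList _).symm⟩
  have hlen : l.length = d + 1 := by
    rw [← hdeg, hspl.natDegree_eq_card_roots, hl]; rfl
  have hneg : ∀ i : Fin l.length, l[i] < 0 := by
    intro i
    have hm : l[i] ∈ R.roots := by rw [hl]; simp
    have := (hroots (l[i] : ℝ) (by
      have := (mem_roots hR0).mp hm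
      rw [IsRoot.def] at this
      have h2 := aeval_algebraMap_apply ℂ (l[i] : ℝ) R
      rw [coe_aeval_eq_eval, this] at h2
      simpa using h2)).2
    simpa using this
  have hprod : R = C R.leadingCoeff * ∏ i : Fin l.length, (X - C l[i]) := by
    conv_lhs => rw [hspl.eq_prod_roots, hl]
    rw [show ∏ i : Fin l.length, (X - C l[i]) = (l.map fun a => X - C a).prod from
      Fin.prod_univ_fun_getElem l (fun a => X - C a)]
    simp
  set a : Fin l.length → ℝ := fun i => -(l[i])⁻¹ with ha
  have hapos : ∀ i, 0 < a i := fun i => by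
    simp only [ha]; exact neg_pos.mpr (inv_lt_zero.mpr (hneg i))
  set K : ℝ := R.leadingCoeff * ∏ i : Fin l.length, (-l[i]) with hK
  have hform : R = C K * ∏ i : Fin l.length, (1 + C (a i) * X) := by
    conv_lhs => rw [hprod]
    rw [hK, C_mul, mul_assoc, map_prod, ← Finset.prod_mul_distrib]
    congr 1
    refine Finset.prod_congr rfl fun i _ => ?_
    have := (hneg i).ne
    rw [mul_add, ← mul_assoc, ← C_mul, ha]
    have : -l[i] * -(l[i])⁻¹ = 1 := by field_simp
    simp only [this]
    simp; ring
  have hev : ∀ t : ℝ, R.eval t = K * ∏ i, (1 + a i * t) := fun t => by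
    conv_lhs => rw [hform]
    simp [eval_prod]
  have hcoef : R.coeff 1 = K * ∑ i, a i := by
    conv_lhs => rw [hform]
    rw [coeff_C_mul, (coeff_prod_one_add_C_mul_X _ a).2]
  have : Nonempty (Fin l.length) := ⟨⟨0, by omega⟩⟩
  have hSpos : 0 < ∑ i, a i := Finset.sum_pos (fun i _ => hapos i) Finset.univ_nonempty
  set S := ∑ i, a i with hS
  have hKpos : 0 < K := by
    have h1 := hc 1 one_pos
    rw [hev] at h1
    have h2 : 0 < ∏ i, (1 + a i * 1) := Finset.prod_pos fun i _ => by linarith [hapos i]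
    by_contra hn
    nlinarith
  have hmain : ∀ t : ℝ, 0 < t → c * t ≤ K * (1 + t * S / (d + 1)) ^ (d + 1) := by
    intro t ht
    refine (hc t ht).trans ?_
    rw [hev]
    have := Finset.prod_one_add_le_pow (a := fun i => a i * t)
      (fun i => (mul_pos (hapos i) ht).le)
    rw [← Finset.sum_mul, Fintype.card_fin, ← hS] at this
    refine mul_le_mul_of_nonneg_left (this.trans (le_of_eq ?_)) hKpos.le
    rw [mul_comm t, hlen]
    push_cast
    rfl
  rw [hcoef]
  rcases Nat.eq_zero_or_pos d with rfl | hd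
  · simp only [pow_zero, one_mul]
    by_contra hlt
    push Not at hlt
    -- For d = 0 the optimum lies at infinity; this t is large enough to turn (c − K S) t ≤ K into K
    -- + 1 ≤ K.
    have := hmain ((K + 1) / (c - K * S)) (by have : 0 < c - K * S := by linarith
                                              positivity)
    have h3 : 0 < c - K * S := by linarith
    have h4 : (c - K * S) * ((K + 1) / (c - K * S)) = K + 1 := by field_simp
    simp at this
    nlinarith
  · have hd' : (0 : ℝ) < d := by exact_mod_cast hd
    -- The minimiser over t > 0 of (1 + tS/(d+1))^(d+1) / t.
    have h1 := hmain ((d + 1) / (d * S)) (by positivity)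
    have h2 : 1 + (d + 1) / (d * S) * S / (d + 1) = ((d : ℝ) + 1) / d := by field_simp
    rw [h2, pow_succ] at h1
    have h3 : 0 < (((d : ℝ) + 1) / d) ^ d := by positivity
    have h4 : ((d : ℝ) / (d + 1)) ^ d * (((d : ℝ) + 1) / d) ^ d = 1 := by
      rw [← mul_pow, div_mul_div_cancel₀ (by positivity), div_self hd'.ne', one_pow]
    have h5 : c ≤ K * S * (((d : ℝ) + 1) / d) ^ d := by
      have h6 : c * ((d + 1) / (d * S)) = (c / S) * ((d + 1) / d) := by field_simp
      rw [h6, ← mul_assoc] at h1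
      have h7 := le_of_mul_le_mul_right h1 (by positivity)
      rw [div_le_iff₀ hSpos] at h7
      linarith
    calc ((d : ℝ) / (d + 1)) ^ d * c
        ≤ ((d : ℝ) / (d + 1)) ^ d * (K * S * (((d : ℝ) + 1) / d) ^ d) := by gcongr
      _ = K * S * (((d : ℝ) / (d + 1)) ^ d * (((d : ℝ) + 1) / d) ^ d) := by ring
      _ = K * S := by rw [h4, mul_one]

/-! ### Half-plane stable polynomials and the capacity induction. -/

open MvPolynomial in
theorem MvPolynomial.aeval_cons_eq_eval_map {A : Type*} [CommRing A] [Algebra ℝ A] {n : ℕ}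
    (s : Fin n → A) (y : A) (f : MvPolynomial (Fin (n + 1)) ℝ) :
    aeval (Fin.cons y s : Fin (n + 1) → A) f =
      ((finSuccEquiv ℝ n f).map (aeval s : MvPolynomial (Fin n) ℝ →ₐ[ℝ] A).toRingHom).eval y := by
  induction f using MvPolynomial.induction_on with
  | C a =>
    rw [← algebraMap_eq, AlgHom.commutes, AlgEquiv.commutes, Polynomial.algebraMap_apply]
    simp
  | add p q hp hq => simp [hp, hq]
  | mul_X p i hp =>
    rw [map_mul, hp, map_mul, Polynomial.map_mul, Polynomial.eval_mul]
    congr 1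
    refine Fin.cases ?_ (fun j => ?_) i
    · simp [finSuccEquiv_X_zero]
    · simp [finSuccEquiv_X_succ]

open MvPolynomial in
theorem MvPolynomial.aeval_mul_of_isHomogeneous {A : Type*} [CommRing A] [Algebra ℝ A] {n d : ℕ}
    {P : MvPolynomial (Fin n) ℝ} (hP : P.IsHomogeneous d) (c : A) (z : Fin n → A) :
    aeval (fun i => c * z i) P = c ^ d * aeval z P := by
  rw [aeval_def, aeval_def, eval₂_eq', eval₂_eq', Finset.mul_sum]
  refine Finset.sum_congr rfl fun m hm => ?_
  have : ∑ i, m i = d := by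
    have h := hP (mem_support_iff.mp hm)
    rw [← h, Finsupp.weight_apply, Finsupp.sum_fintype _ _ (by simp)]
    simp
  simp_rw [mul_pow, Finset.prod_mul_distrib, Finset.prod_pow_eq_pow_sum, this]
  ring

/-- The univariate polynomial `t ↦ P (t, s)`. -/
noncomputable def MvPolynomial.firstVar {A : Type*} [CommRing A] [Algebra ℝ A] {n : ℕ}
    (P : MvPolynomial (Fin (n + 1)) ℝ) (s : Fin n → A) : Polynomial A :=
  (finSuccEquiv ℝ n P).map (aeval s : MvPolynomial (Fin n) ℝ →ₐ[ℝ] A).toRingHom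

/-- A real polynomial without complex zeros in the closed right half-space, apart from points of
its imaginary boundary. -/
def MvPolynomial.IsHalfPlaneStable {n : ℕ} (P : MvPolynomial (Fin n) ℝ) : Prop :=
  ∀ z : Fin n → ℂ, (∀ i, 0 ≤ (z i).re) → (∃ i, 0 < (z i).re) → aeval z P ≠ 0

namespace MvPolynomial

/-- By homogeneity this coefficient is P(1, 0, …, 0). It fixes the degree in the first variable,
whatever values the other variables take. -/
theorem IsHalfPlaneStable.coeff_cons_zero_ne_zero {n d : ℕ} {P : MvPolynomial (Fin (n + 1)) ℝ}
    (hst : P.IsHalfPlaneStable) (hP : P.IsHomogeneous d) :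
    P.coeff (Finsupp.cons d 0) ≠ 0 := by
  intro h0
  refine hst (Fin.cons 1 0) (fun i => ?_) ⟨0, by simp⟩ ?_
  · refine Fin.cases ?_ (fun j => ?_) i <;> simp
  · rw [aeval_cons_eq_eval_map]
    suffices h : (finSuccEquiv ℝ n P).map
        (aeval (0 : Fin n → ℂ) : MvPolynomial (Fin n) ℝ →ₐ[ℝ] ℂ).toRingHom = 0 by
      rw [h, Polynomial.eval_zero]
    ext1 k
    rw [Polynomial.coeff_map, Polynomial.coeff_zero]
    change aeval (0 : Fin n → ℂ) _ = 0
    rw [aeval_zero, constantCoeff_eq, finSuccEquiv_coeff_coeff]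
    by_cases hk : k = d
    · rw [hk, h0, map_zero]
    · rw [hP.coeff_eq_zero, map_zero]
      intro h
      apply hk
      rw [← h, Finsupp.degree_eq_sum, Fin.sum_univ_succ]
      simp

theorem IsHalfPlaneStable.natDegree_firstVar {A : Type*} [CommRing A] [Nontrivial A] [Algebra ℝ A]
    {n d : ℕ} {P : MvPolynomial (Fin (n + 1)) ℝ}
    (hst : P.IsHalfPlaneStable) (hP : P.IsHomogeneous d) (s : Fin n → A) :
    (P.firstVar s).natDegree = d := by
  refine Polynomial.natDegree_eq_of_le_of_coeff_ne_zero ?_ ?_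
  · rw [Polynomial.natDegree_le_iff_coeff_eq_zero]
    intro k hk
    rw [firstVar, Polynomial.coeff_map]
    have : (finSuccEquiv ℝ n P).coeff k = 0 := by
      ext m
      rw [finSuccEquiv_coeff_coeff, hP.coeff_eq_zero, coeff_zero]
      rw [Finsupp.degree_eq_sum, Fin.sum_univ_succ]
      simp
      omega
    rw [this, map_zero]
  · rw [firstVar, Polynomial.coeff_map]
    have h1 := hP.finSuccEquiv_coeff_isHomogeneous d 0 (by simp)
    have h2 := totalDegree_eq_zero_iff_eq_C.mp (Nat.le_zero.mp h1.totalDegree_le)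
    rw [h2, finSuccEquiv_coeff_coeff]
    change aeval s (C _) ≠ 0
    rw [← algebraMap_eq, AlgHom.commutes]
    exact (map_ne_zero_iff _ (FaithfulSMul.algebraMap_injective ℝ A)).mpr
      (hst.coeff_cons_zero_ne_zero hP)

theorem eval_firstVar {A : Type*} [CommRing A] [Algebra ℝ A] {n : ℕ}
    (P : MvPolynomial (Fin (n + 1)) ℝ) (s : Fin n → A) (t : A) :
    (P.firstVar s).eval t = aeval (Fin.cons t s : Fin (n + 1) → A) P :=
  (aeval_cons_eq_eval_map s t P).symm

theorem coeff_firstVar {A : Type*} [CommRing A] [Algebra ℝ A] {n : ℕ}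
    (P : MvPolynomial (Fin (n + 1)) ℝ) (s : Fin n → A) (k : ℕ) :
    (P.firstVar s).coeff k = aeval s ((finSuccEquiv ℝ n P).coeff k) := by
  rw [firstVar, Polynomial.coeff_map]; rfl

theorem map_firstVar {n : ℕ} (P : MvPolynomial (Fin (n + 1)) ℝ) (s : Fin n → ℝ) :
    (P.firstVar s).map (algebraMap ℝ ℂ) = P.firstVar (fun i => (s i : ℂ)) := by
  ext k
  rw [Polynomial.coeff_map, coeff_firstVar, coeff_firstVar]
  exact (aeval_algebraMap_apply ℂ s _).symm

theorem IsHalfPlaneStable.coeff_one {n d : ℕ} {P : MvPolynomial (Fin (n + 1)) ℝ}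
    (hst : P.IsHalfPlaneStable) (hP : P.IsHomogeneous (d + 1)) :
    ((finSuccEquiv ℝ n P).coeff 1).IsHalfPlaneStable := by
  intro z hz hz'
  rw [← coeff_firstVar]
  refine Polynomial.coeff_one_ne_zero_of_roots_re_neg ?_ fun t ht => ?_
  · rw [hst.natDegree_firstVar hP]; omega
  · rw [eval_firstVar]
    refine hst _ (fun i => ?_) ?_
    · refine Fin.cases ?_ (fun j => ?_) i
      · simpa using ht
      · simpa using hz j
    · obtain ⟨i, hi⟩ := hz'
      exact ⟨i.succ, by simpa using hi⟩

/-- Homogeneity allows a zero (t, x) to be multiplied by any complex w. Unless t is a negative real,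
some w with Re w > 0 has Re (wt) ≥ 0, which moves the zero into the forbidden region. -/
theorem IsHalfPlaneStable.root_neg {n d : ℕ} {P : MvPolynomial (Fin (n + 2)) ℝ}
    (hst : P.IsHalfPlaneStable) (hP : P.IsHomogeneous d) {x : Fin (n + 1) → ℝ}
    (hx : ∀ i, 0 < x i) {t : ℂ} (ht : Polynomial.aeval t (P.firstVar x) = 0) :
    t.im = 0 ∧ t.re < 0 := by
  by_contra hcon
  have h0 : aeval (Fin.cons t (fun i => (x i : ℂ)) : Fin (n + 2) → ℂ) P = 0 := by
    rw [← eval_firstVar, ← map_firstVar, Polynomial.eval_map_algebraMap, ht]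
  obtain ⟨w, hw, hwt⟩ : ∃ w : ℂ, 0 < w.re ∧ 0 ≤ (w * t).re := by
    by_cases hre : 0 ≤ t.re
    · exact ⟨1, by simp, by simpa using hre⟩
    · push Not at hre
      have him : t.im ≠ 0 := fun h => hcon ⟨h, hre⟩
      -- This w makes w t purely imaginary.
      refine ⟨⟨t.im ^ 2 / (-t.re), -t.im⟩, ?_, ?_⟩
      · have : 0 < -t.re := by linarith
        positivity
      · simp only [Complex.mul_re]
        have : t.im ^ 2 / -t.re * t.re = - t.im ^ 2 := by
          have := hre.ne
          field_simp
        rw [this]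
        apply le_of_eq
        ring
  refine hst (fun i => w * (Fin.cons t (fun i => (x i : ℂ)) : Fin (n + 2) → ℂ) i) (fun i => ?_)
    ⟨1, ?_⟩ ?_
  · refine Fin.cases ?_ (fun j => ?_) i
    · simpa using hwt
    · simpa using mul_nonneg hw.le (hx j).le
  · rw [show (1 : Fin (n + 2)) = Fin.succ 0 from rfl]
    simpa using mul_pos hw (hx 0)
  · rw [aeval_mul_of_isHomogeneous hP, h0, mul_zero]

theorem IsHalfPlaneStable.le_coeff_ones : ∀ (n : ℕ) {P : MvPolynomial (Fin (n + 1)) ℝ},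
    P.IsHalfPlaneStable → P.IsHomogeneous (n + 1) → ∀ {c : ℝ}, 0 < c →
    (∀ x : Fin (n + 1) → ℝ, (∀ i, 0 < x i) → c * ∏ i, x i ≤ aeval x P) →
    ((n + 1).factorial : ℝ) / ((n + 1 : ℕ) : ℝ) ^ (n + 1) * c ≤
      P.coeff (Finsupp.equivFunOnFinite.symm fun _ => 1) := by
  intro n
  induction n with
  | zero =>
    intro P hst hP c hc hle
    have h1 := hle (fun _ => 1) (fun _ => one_pos)
    rw [aeval_def, eval₂_eq'] at h1
    simp only [Finset.prod_const_one, mul_one, one_pow] at h1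
    refine le_trans (by simp) (h1.trans ?_)
    have : P.support ⊆ {Finsupp.equivFunOnFinite.symm fun _ => 1} := by
      intro m hm
      have h := hP (mem_support_iff.mp hm)
      rw [Finsupp.weight_apply, Finsupp.sum_fintype _ _ (by simp)] at h
      simp at h
      rw [Finset.mem_singleton]
      ext i
      refine Fin.cases ?_ (fun j => j.elim0) i
      simpa using h
    rw [Finset.sum_subset this (by simp)]
    simp
  | succ n ih =>
    intro P hst hP c hc hle
    -- Each extraction costs a factor (k/(k+1))^k; the product over k = 1, …, n+1 is
    -- (n+2)!/(n+2)^(n+2).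
    have hq := ih (hst.coeff_one hP)
      (hP.finSuccEquiv_coeff_isHomogeneous 1 (n + 1) (by ring))
      (c := (((n + 1 : ℕ) : ℝ) / ((n + 1 : ℕ) + 1)) ^ (n + 1) * c) (by positivity) ?_
    · rw [finSuccEquiv_coeff_coeff] at hq
      have h1 : (Finsupp.cons 1 (Finsupp.equivFunOnFinite.symm fun _ => 1) : Fin (n + 2) →₀ ℕ)
          = Finsupp.equivFunOnFinite.symm fun _ => 1 := by
        ext i
        refine Fin.cases ?_ (fun j => ?_) i <;> simp
      rw [h1] at hq
      refine le_trans (le_of_eq ?_) hq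
      rw [Nat.factorial_succ (n + 1), div_pow]
      push_cast
      field_simp
      ring
    · intro x hx
      have hprod : 0 < ∏ i, x i := Finset.prod_pos fun i _ => hx i
      rw [← coeff_firstVar, mul_assoc]
      refine Polynomial.le_coeff_one_of_roots_neg (hst.natDegree_firstVar hP x)
        (fun w hw => hst.root_neg hP hx hw) (fun t ht => ?_) (mul_pos hc hprod)
      rw [eval_firstVar]
      refine le_trans (le_of_eq ?_) (hle (Fin.cons t x) fun i => ?_)
      · rw [Fin.prod_cons]
        ring
      · refine Fin.cases ?_ (fun j => ?_) i
        · simpa using ht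
        · simpa using hx j

end MvPolynomial

/-! ### The van der Waerden lower bound. -/

namespace Matrix
open MvPolynomial

/-- The product of the linear forms given by the rows of a matrix. -/
noncomputable def rowProduct {n : ℕ} (B : Matrix (Fin n) (Fin n) ℝ) : MvPolynomial (Fin n) ℝ :=
  ∏ i, ∑ j, C (B i j) * X j

theorem isHomogeneous_rowProduct {n : ℕ} (B : Matrix (Fin n) (Fin n) ℝ) :
    B.rowProduct.IsHomogeneous n := by
  have := IsHomogeneous.prod Finset.univ (fun i => ∑ j, C (B i j) * (X j : MvPolynomial (Fin n) ℝ))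
    (fun _ => 1) fun i _ => IsHomogeneous.sum _ _ _ fun j _ => by
      simpa using (isHomogeneous_C (Fin n) (B i j)).mul (isHomogeneous_X ℝ j)
  rw [rowProduct]
  simpa using this

theorem aeval_rowProduct {A : Type*} [CommRing A] [Algebra ℝ A] {n : ℕ}
    (B : Matrix (Fin n) (Fin n) ℝ) (z : Fin n → A) :
    aeval z B.rowProduct = ∏ i, ∑ j, algebraMap ℝ A (B i j) * z j := by
  simp [rowProduct, map_prod]

theorem coeff_rowProduct {n : ℕ} (B : Matrix (Fin n) (Fin n) ℝ) :
    B.rowProduct.coeff (Finsupp.equivFunOnFinite.symm fun _ => 1) = B.permanent := by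
  classical
  have hmon : ∀ f : Fin n → Fin n, ∏ i, (C (B i (f i)) * X (f i) : MvPolynomial (Fin n) ℝ) =
      monomial (∑ i, Finsupp.single (f i) 1) (∏ i, B i (f i)) := fun f => by
    rw [Finset.prod_mul_distrib, ← map_prod, monomial_sum_index]
    rfl
  rw [rowProduct, Finset.prod_univ_sum, Fintype.piFinset_univ, coeff_sum]
  simp_rw [hmon, coeff_monomial]
  rw [← permanent_transpose, permanent]
  -- The exponent of X_j counts the preimages of j, so the all-ones monomial comes exactly from the
  -- permutations.
  have hiff : ∀ f : Fin n → Fin n, (∑ i, Finsupp.single (f i) 1 =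
      (Finsupp.equivFunOnFinite.symm fun _ => 1 : Fin n →₀ ℕ)) ↔ Function.Bijective f := by
    intro f
    constructor
    · intro h
      refine Finite.surjective_iff_bijective.mp fun j => ?_
      have := DFunLike.congr_fun h j
      simp only [Finsupp.coe_finsetSum, Finset.sum_apply, Finsupp.equivFunOnFinite_symm_apply_apply]
        at this
      obtain ⟨i, -, hi⟩ := Finset.exists_ne_zero_of_sum_ne_zero (this.trans_ne one_ne_zero)
      exact ⟨i, by by_contra hne; exact hi (Finsupp.single_eq_of_ne (Ne.symm hne))⟩
    · intro h
      ext j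
      obtain ⟨i, rfl⟩ := h.2 j
      simp only [Finsupp.coe_finsetSum, Finset.sum_apply, Finsupp.equivFunOnFinite_symm_apply_apply]
      rw [Finset.sum_eq_single i]
      · simp
      · intro k _ hk
        exact Finsupp.single_eq_of_ne (fun h' => hk (h.1 h'.symm))
      · simp
  simp_rw [hiff]
  rw [← Finset.sum_filter]
  refine Finset.sum_bij' (fun f hf => Equiv.ofBijective f (Finset.mem_filter.mp hf).2)
    (fun σ _ => σ) ?_ ?_ ?_ ?_ ?_
  · simp
  · intro σ _
    exact Finset.mem_filter.mpr ⟨Finset.mem_univ _, σ.bijective⟩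
  · intros; rfl
  · intros; ext; rfl
  · intros; rfl

theorem le_permanent_of_pos {n : ℕ} (B : Matrix (Fin (n + 1)) (Fin (n + 1)) ℝ)
    (hB : B ∈ doublyStochastic ℝ (Fin (n + 1))) (hpos : ∀ i j, 0 < B i j) :
    ((n + 1).factorial : ℝ) / ((n + 1 : ℕ) : ℝ) ^ (n + 1) ≤ B.permanent := by
  have hst : B.rowProduct.IsHalfPlaneStable := by
    intro z hz ⟨k, hk⟩
    rw [aeval_rowProduct, Finset.prod_ne_zero_iff]
    intro i _ h
    have h1 : (∑ j, algebraMap ℝ ℂ (B i j) * z j).re = ∑ j, B i j * (z j).re := by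
      simp
    have h2 : 0 < ∑ j, B i j * (z j).re :=
      Finset.sum_pos' (fun j _ => mul_nonneg (hpos i j).le (hz j))
        ⟨k, Finset.mem_univ k, mul_pos (hpos i k) hk⟩
    rw [h] at h1
    simp only [Complex.zero_re] at h1
    linarith
  have := hst.le_coeff_ones n B.isHomogeneous_rowProduct (c := 1) one_pos fun x hx => ?_
  · rwa [mul_one, coeff_rowProduct] at this
  · rw [aeval_rowProduct, one_mul]
    -- Unit column sums distribute each x_j over the rows; unit row sums make each row a weighted
    -- AM–GM.
    calc ∏ j, x j = ∏ i, ∏ j, x j ^ B i j := by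
          rw [Finset.prod_comm]
          refine Finset.prod_congr rfl fun j _ => ?_
          rw [← Real.rpow_sum_of_pos (hx j), sum_col_of_mem_doublyStochastic hB, Real.rpow_one]
      _ ≤ _ := Finset.prod_le_prod
          (fun i _ => Finset.prod_nonneg fun j _ => Real.rpow_nonneg (hx j).le _)
          fun i _ => Real.geom_mean_le_arith_mean_weighted _ _ _ (fun j _ => (hpos i j).le)
            (sum_row_of_mem_doublyStochastic hB i) fun j _ => (hx j).le

/-- The **van der Waerden bound** for the permanent of a doubly stochastic matrix. -/
theorem le_permanent_of_mem_doublyStochastic {n : ℕ} (hn : 1 ≤ n) (B : Matrix (Fin n) (Fin n) ℝ)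
    (hB : B ∈ doublyStochastic ℝ (Fin n)) :
    (n.factorial : ℝ) / (n : ℝ) ^ n ≤ B.permanent := by
  obtain ⟨n, rfl⟩ : ∃ m, n = m + 1 := ⟨n - 1, by omega⟩
  -- Mixing with the uniform matrix makes all entries positive; the weight of the mixture then tends
  -- to 0.
  set J : Matrix (Fin (n + 1)) (Fin (n + 1)) ℝ := fun _ _ => ((n + 1 : ℕ) : ℝ)⁻¹ with hJ
  have hJmem : J ∈ doublyStochastic ℝ (Fin (n + 1)) := by
    have h0 : ((n : ℝ) + 1) ≠ 0 := by positivity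
    rw [mem_doublyStochastic_iff_sum]
    refine ⟨fun i j => by positivity, fun i => ?_, fun j => ?_⟩ <;> simp [hJ, h0]
  have hcont : Continuous fun e : ℝ => ((1 - e) • B + e • J).permanent := by
    unfold permanent
    simp only [Matrix.add_apply, Matrix.smul_apply, smul_eq_mul]
    fun_prop
  have hlim : Filter.Tendsto (fun e : ℝ => ((1 - e) • B + e • J).permanent)
      (nhdsWithin 0 (Set.Ioi 0)) (nhds B.permanent) := by
    have := hcont.tendsto 0
    simp only [sub_zero, one_smul, zero_smul, add_zero] at this
    exact this.mono_left nhdsWithin_le_nhds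
  refine ge_of_tendsto hlim ?_
  filter_upwards [Ioo_mem_nhdsGT (zero_lt_one' ℝ)] with e he
  refine le_permanent_of_pos _ (convex_doublyStochastic hB hJmem (by linarith [he.2]) he.1.le
    (by ring)) fun i j => ?_
  have h1 := nonneg_of_mem_doublyStochastic hB (i := i) (j := j)
  have h2 : 0 < e * J i j := mul_pos he.1 (by simp only [hJ]; positivity)
  simp only [Matrix.add_apply, Matrix.smul_apply, smul_eq_mul]
  have := mul_nonneg (sub_nonneg.mpr he.2.le) h1
  linarith

end Matrix

/-! ### The Bregman–Minc inequality, by Schrijver's convexity argument. -/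

/-- The logarithm of `(k!) ^ (1 / k)`. -/
noncomputable def logFactorialMean (k : ℕ) : ℝ := Real.log k.factorial / k

theorem mul_logFactorialMean (k : ℕ) : k * logFactorialMean k = Real.log k.factorial := by
  rcases Nat.eq_zero_or_pos k with rfl | hk
  · simp
  · have : (k : ℝ) ≠ 0 := by positivity
    rw [logFactorialMean]
    field_simp

theorem Finset.sum_mul_log_sum_le {ι : Type*} {s : Finset ι} (hs : s.Nonempty) {m : ι → ℝ}
    (hm : ∀ i ∈ s, 0 ≤ m i) (hpos : 0 < ∑ i ∈ s, m i) :
    (∑ i ∈ s, m i) * Real.log (∑ i ∈ s, m i) ≤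
      (∑ i ∈ s, m i) * Real.log s.card + ∑ i ∈ s, m i * Real.log (m i) := by
  have hc : (0 : ℝ) < s.card := by exact_mod_cast hs.card_pos
  have := Real.convexOn_mul_log.map_sum_le (t := s) (w := fun _ => (s.card : ℝ)⁻¹) (p := m)
    (fun _ _ => by positivity) (by simp [hc.ne']) hm
  simp only [smul_eq_mul, ← Finset.mul_sum] at this
  rw [Real.log_mul (by positivity) hpos.ne', Real.log_inv, mul_assoc] at this
  have := le_of_mul_le_mul_left this (by positivity)
  linarith

section Matchings

variable {α β : Type} [Fintype α] [DecidableEq α] [Fintype β] [DecidableEq β]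

/-- The bijections whose graph is contained in the relation given by `S`. -/
def perfectMatchings (S : α → Finset β) : Finset (α ≃ β) :=
  Finset.univ.filter fun e => ∀ a, e a ∈ S a

theorem mem_perfectMatchings {S : α → Finset β} {e : α ≃ β} :
    e ∈ perfectMatchings S ↔ ∀ a, e a ∈ S a := by simp [perfectMatchings]

theorem card_perfectMatchings_filter_le (S : α → Finset β) (i : α) (k : β) :
    ((perfectMatchings S).filter fun e => e i = k).card ≤
      (perfectMatchings fun a : {a // a ≠ i} => (S a).subtype (· ≠ k)).card := by
  rw [← Fintype.card_coe, ← Fintype.card_coe]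
  have key : ∀ e : {e // e ∈ (perfectMatchings S).filter fun e => e i = k}, ∀ a,
      a ≠ i ↔ e.1 a ≠ k := by
    intro e a
    have h : e.1 a ≠ e.1 i ↔ a ≠ i := e.1.injective.ne_iff
    rw [(Finset.mem_filter.mp e.2).2] at h
    exact h.symm
  refine Fintype.card_le_of_injective
    (fun e => ⟨e.1.subtypeEquiv (key e), ?_⟩) ?_
  · rw [mem_perfectMatchings]
    intro a
    rw [Finset.mem_subtype]
    exact mem_perfectMatchings.mp (Finset.mem_filter.mp e.2).1 a
  · intro e f hef
    apply Subtype.ext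
    ext a
    by_cases ha : a = i
    · rw [ha, (Finset.mem_filter.mp e.2).2, (Finset.mem_filter.mp f.2).2]
    · have := congrArg Subtype.val (DFunLike.congr_fun (congrArg Subtype.val hef) ⟨a, ha⟩)
      simpa using this

/-- With r = |T|, the r − 1 columns of T other than b contribute log (r−1)! in total, and each of
the remaining |β| − r columns leaves T unchanged. The −log r left over cancels the log r of the
convexity step. -/
theorem sum_erase_logFactorialMean (T : Finset β) {b : β} (hb : b ∈ T) :
    ∑ k ∈ Finset.univ.erase b, logFactorialMean (T.erase k).card =
      Fintype.card β * logFactorialMean T.card - Real.log T.card := by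
  obtain ⟨r, hr⟩ : ∃ r, T.card = r + 1 := ⟨T.card - 1, by have := Finset.card_pos.mpr ⟨b, hb⟩; omega⟩
  rw [← Finset.sum_filter_add_sum_filter_not _ (· ∈ T)]
  have h1 : (Finset.univ.erase b).filter (· ∈ T) = T.erase b := by ext; simp
  have h2 : (Finset.univ.erase b).filter (· ∉ T) = Tᶜ := by
    ext x
    simp only [Finset.mem_filter, Finset.mem_erase, Finset.mem_univ, and_true, Finset.mem_compl,
      and_iff_right_iff_imp]
    rintro h rfl
    exact h hb
  rw [h1, h2, Finset.sum_congr rfl fun k hk => by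
      rw [Finset.card_erase_of_mem (Finset.mem_of_mem_erase hk), hr],
    Finset.sum_congr (s₁ := Tᶜ) rfl fun k hk => by
      rw [Finset.erase_eq_of_notMem (Finset.mem_compl.mp hk)]]
  rw [Finset.sum_const, Finset.sum_const, Finset.card_erase_of_mem hb, Finset.card_compl, hr]
  have hle : r + 1 ≤ Fintype.card β := hr ▸ Finset.card_le_univ T
  simp only [Nat.add_sub_cancel, nsmul_eq_mul]
  rw [Nat.cast_sub hle, mul_logFactorialMean, sub_mul, mul_logFactorialMean (r + 1),
    Nat.factorial_succ, Nat.cast_mul, Real.log_mul (by positivity) (by positivity)]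
  ring

end Matchings

/-- For each row i, convexity of x log x compares P log P, P being the number of matchings, with the
counts m i k of matchings sending i to k. These counts are bounded by induction on the minors.
Summing over all i, and regrouping by matching, makes the correction terms cancel. -/
theorem log_card_perfectMatchings_le : ∀ (n : ℕ) {α β : Type} [Fintype α] [DecidableEq α]
    [Fintype β] [DecidableEq β] (S : α → Finset β), Fintype.card α = n →
    (perfectMatchings S).Nonempty →
    Real.log (perfectMatchings S).card ≤ ∑ a, logFactorialMean (S a).card := by
  intro n
  induction n with
  | zero =>
    intro α β _ _ _ _ S hn ⟨e, he⟩
    have : IsEmpty α := Fintype.card_eq_zero_iff.mp hn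
    have h1 : (perfectMatchings S).card ≤ 1 := Finset.card_le_one.mpr fun a _ b _ => by
      ext x; exact this.elim x
    have h2 : (perfectMatchings S).card = 1 := le_antisymm h1 (Finset.card_pos.mpr ⟨e, he⟩)
    simp [h2]
  | succ n ih =>
    intro α β _ _ _ _ S hn hne
    set F := perfectMatchings S with hF
    obtain ⟨e₀, he₀⟩ := hne
    have hcard : Fintype.card β = n + 1 := by rw [← hn, Fintype.card_congr e₀]
    have hPpos : (0 : ℝ) < F.card := by exact_mod_cast Finset.card_pos.mpr ⟨e₀, he₀⟩
    set m : α → β → ℝ := fun i k => ((F.filter fun e => e i = k).card : ℝ) with hm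
    have hmaps : ∀ i, ∀ e ∈ F, e i ∈ S i := fun i e he => mem_perfectMatchings.mp he i
    have hsum : ∀ i, ∑ k ∈ S i, m i k = F.card := fun i => by
      rw [Finset.card_eq_sum_card_fiberwise (hmaps i)]
      push_cast
      rfl
    have hlog : ∀ i, ∑ k ∈ S i, m i k * Real.log (m i k) = ∑ e ∈ F, Real.log (m i (e i)) := by
      intro i
      rw [← Finset.sum_fiberwise_of_maps_to (hmaps i)]
      refine Finset.sum_congr rfl fun k _ => ?_
      rw [Finset.sum_congr rfl fun e he => by rw [(Finset.mem_filter.mp he).2], Finset.sum_const,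
        nsmul_eq_mul]
    have hrow : ∀ i, F.card * Real.log F.card ≤
        F.card * Real.log (S i).card + ∑ e ∈ F, Real.log (m i (e i)) := by
      intro i
      have := Finset.sum_mul_log_sum_le (s := S i) ⟨_, hmaps i e₀ he₀⟩ (m := m i)
        (fun _ _ => Nat.cast_nonneg _) (by rw [hsum]; exact hPpos)
      rwa [hsum, hlog] at this
    have hminor : ∀ e ∈ F, ∀ i, Real.log (m i (e i)) ≤
        ∑ j ∈ Finset.univ.erase i, logFactorialMean ((S j).erase (e i)).card := by
      intro e he i
      have h1 := card_perfectMatchings_filter_le S i (e i)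
      have h0 : 0 < (F.filter fun f => f i = e i).card :=
        Finset.card_pos.mpr ⟨e, Finset.mem_filter.mpr ⟨he, rfl⟩⟩
      have h2 := ih (fun a : {a // a ≠ i} => (S a).subtype (· ≠ e i))
        (by rw [Fintype.card_subtype_compl, Fintype.card_subtype_eq, hn]; rfl)
        (Finset.card_pos.mp (h0.trans_le h1))
      refine (Real.log_le_log (Nat.cast_pos.mpr h0) (Nat.cast_le.mpr h1)).trans (h2.trans ?_)
      have h3 : ∀ j, ((S j).subtype (· ≠ e i)).card = ((S j).erase (e i)).card := fun j => by
        rw [Finset.card_subtype, Finset.filter_ne']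
      simp_rw [h3]
      rw [← Finset.sum_subtype (Finset.univ.erase i) (p := fun a => a ≠ i) (by simp)
        (fun j => logFactorialMean ((S j).erase (e i)).card)]
    have hswap : ∀ e ∈ F, ∑ i, Real.log (m i (e i)) ≤
        ∑ j, ((n + 1 : ℕ) * logFactorialMean (S j).card - Real.log (S j).card) := by
      intro e he
      refine (Finset.sum_le_sum fun i _ => hminor e he i).trans (le_of_eq ?_)
      -- For fixed j, as i runs over the other rows, e i runs over all columns other than e j.
      rw [Finset.sum_comm' (s' := fun j => Finset.univ.erase j) (t' := Finset.univ)
        (by intro x y; simp [eq_comm])]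
      refine Finset.sum_congr rfl fun j _ => ?_
      rw [← hcard, ← sum_erase_logFactorialMean (S j) (hmaps j e he)]
      refine Finset.sum_equiv e (by simp) (by simp)
    have htotal : (n + 1 : ℕ) * (F.card * Real.log F.card) ≤
        F.card * ((n + 1 : ℕ) * ∑ j, logFactorialMean (S j).card) := by
      calc (n + 1 : ℕ) * (F.card * Real.log F.card) = ∑ _i : α, F.card * Real.log F.card := by
            rw [Finset.sum_const, Finset.card_univ, hn, nsmul_eq_mul]
        _ ≤ ∑ i, (F.card * Real.log (S i).card + ∑ e ∈ F, Real.log (m i (e i))) :=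
            Finset.sum_le_sum fun i _ => hrow i
        _ = F.card * ∑ i, Real.log (S i).card + ∑ e ∈ F, ∑ i, Real.log (m i (e i)) := by
            rw [Finset.sum_add_distrib, Finset.mul_sum, Finset.sum_comm]
        _ ≤ F.card * ∑ i, Real.log (S i).card + ∑ e ∈ F,
            ∑ j, ((n + 1 : ℕ) * logFactorialMean (S j).card - Real.log (S j).card) := by
            exact add_le_add le_rfl (Finset.sum_le_sum hswap)
        _ = _ := by
            rw [Finset.sum_const, Finset.sum_sub_distrib, nsmul_eq_mul, ← Finset.mul_sum]
            ring
    rw [mul_left_comm] at htotal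
    exact le_of_mul_le_mul_left (le_of_mul_le_mul_left htotal hPpos) (by positivity)

/-- The **Bregman–Minc inequality** for the number of perfect matchings. -/
theorem card_perfectMatchings_le {α β : Type} [Fintype α] [DecidableEq α] [Fintype β]
    [DecidableEq β] (S : α → Finset β) :
    ((perfectMatchings S).card : ℝ) ≤ ∏ a, Real.exp (logFactorialMean (S a).card) := by
  rcases (perfectMatchings S).eq_empty_or_nonempty with h | h
  · rw [h]
    simpa using (Finset.prod_pos fun a _ => Real.exp_pos _).le
  · rw [← Real.exp_sum, ← Real.log_le_iff_le_exp (by exact_mod_cast h.card_pos)]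
    exact log_card_perfectMatchings_le _ S rfl h

/-! ### From 0-1 matrices to entries in [0, 1]. -/

/-- A k-subset of maximal total weight works, by exchanging one element. -/
theorem Finset.exists_card_eq_forall_le {β : Type} [Fintype β] [DecidableEq β] (c : β → ℝ) {k : ℕ}
    (hk : k ≤ Fintype.card β) :
    ∃ T : Finset β, T.card = k ∧ ∀ i ∈ T, ∀ j ∉ T, c j ≤ c i := by
  obtain ⟨T, hT, hmax⟩ := (Finset.powersetCard k (Finset.univ : Finset β)).exists_max_image
    (fun T => ∑ i ∈ T, c i) (Finset.powersetCard_nonempty.mpr hk)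
  have hTk := (Finset.mem_powersetCard.mp hT).2
  refine ⟨T, hTk, fun i hi j hj => ?_⟩
  have hj' : j ∉ T.erase i := fun h => hj (Finset.mem_of_mem_erase h)
  have := hmax (insert j (T.erase i)) (Finset.mem_powersetCard.mpr ⟨Finset.subset_univ _, by
    rw [Finset.card_insert_of_notMem hj', Finset.card_erase_of_mem hi, hTk]
    have := Finset.card_pos.mpr ⟨i, hi⟩
    omega⟩)
  rw [Finset.sum_insert hj', ← Finset.add_sum_erase T c hi] at this
  linarith

/-- For 0 ≤ a_j ≤ 1 with sum r and k = ⌊r⌋, the sum ∑ a_j c_j is at most the interpolation between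
the sum of the k largest c_j and that of the k+1 largest, with weights k+1−r and r−k. Concavity of φ
bounds the same interpolation of φ(k) and φ(k+1) by φ(r). -/
theorem sum_mul_le_of_concaveOn {β : Type} [Fintype β] [DecidableEq β] {φ : ℝ → ℝ}
    (hφ : ConcaveOn ℝ (Set.Ici 1) φ) {a c : β → ℝ} {K : ℝ} (hK : 0 ≤ K) (ha0 : ∀ j, 0 ≤ a j)
    (ha1 : ∀ j, a j ≤ 1) (hr : 1 ≤ ∑ j, a j)
    (h : ∀ T : Finset β, T.Nonempty → ∑ j ∈ T, c j ≤ φ T.card * K) :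
    ∑ j, a j * c j ≤ φ (∑ j, a j) * K := by
  set r := ∑ j, a j with hrdef
  have hrle : r ≤ Fintype.card β := by
    calc r ≤ ∑ _j : β, (1 : ℝ) := Finset.sum_le_sum fun j _ => ha1 j
      _ = _ := by simp
  set k := ⌊r⌋₊ with hk
  have hk1 : 1 ≤ k := (Nat.one_le_floor_iff _).mpr hr
  have hkr : (k : ℝ) ≤ r := Nat.floor_le (by linarith)
  have hrk : r < k + 1 := Nat.lt_floor_add_one r
  have hkc : k ≤ Fintype.card β := by exact_mod_cast hkr.trans hrle
  obtain ⟨T, hTk, htop⟩ := Finset.exists_card_eq_forall_le c hkc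
  have hTne : T.Nonempty := Finset.card_pos.mp (by omega)
  have hsplit : ∑ j ∈ T, a j + ∑ j ∈ Tᶜ, a j = r := Finset.sum_add_sum_compl T a
  have hsplit' : ∑ j ∈ T, a j * c j + ∑ j ∈ Tᶜ, a j * c j = ∑ j, a j * c j :=
    Finset.sum_add_sum_compl T fun j => a j * c j
  have hone : ∑ j ∈ T, (1 - a j) = k - ∑ j ∈ T, a j := by
    rw [Finset.sum_sub_distrib]; simp [hTk]
  rcases (Tᶜ).eq_empty_or_nonempty with hempty | hne
  · rw [hempty, Finset.sum_empty, add_zero] at hsplit hsplit'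
    have hle : ∀ j ∈ T, 0 ≤ 1 - a j := fun j _ => by linarith [ha1 j]
    have hz := (Finset.sum_eq_zero_iff_of_nonneg hle).mp
      (le_antisymm (by rw [hone]; linarith) (Finset.sum_nonneg hle))
    have hrT : r = T.card := by
      have := Finset.sum_eq_zero hz
      rw [hone] at this
      rw [hTk]; linarith
    rw [← hsplit', hrT]
    refine le_trans (le_of_eq (Finset.sum_congr rfl fun j hj => ?_)) (h T hTne)
    rw [show a j = 1 by linarith [hz j hj], one_mul]
  · obtain ⟨p, hp, hpmax⟩ := (Tᶜ).exists_max_image c hne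
    rw [Finset.mem_compl] at hp
    have h1 : ∑ j ∈ T, (1 - a j) * c p ≤ ∑ j ∈ T, (1 - a j) * c j :=
      Finset.sum_le_sum fun j hj =>
        mul_le_mul_of_nonneg_left (htop j hj p hp) (by linarith [ha1 j])
    have h2 : ∑ j ∈ Tᶜ, a j * c j ≤ ∑ j ∈ Tᶜ, a j * c p :=
      Finset.sum_le_sum fun j hj => mul_le_mul_of_nonneg_left (hpmax j hj) (ha0 j)
    rw [← Finset.sum_mul] at h1 h2
    rw [hone] at h1
    have h3 : ∑ j ∈ T, (1 - a j) * c j = ∑ j ∈ T, c j - ∑ j ∈ T, a j * c j := by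
      rw [← Finset.sum_sub_distrib]
      exact Finset.sum_congr rfl fun j _ => by ring
    rw [h3] at h1
    have h4 : ∑ j ∈ Tᶜ, a j = r - ∑ j ∈ T, a j := by linarith
    rw [h4] at h2
    have h5 := h T hTne
    have h6 := h (insert p T) (Finset.insert_nonempty p T)
    rw [Finset.sum_insert hp, Finset.card_insert_of_notMem hp, hTk] at h6
    rw [hTk] at h5
    push_cast at h6
    have hk1' : (1 : ℝ) ≤ k := by exact_mod_cast hk1
    have hk2 : (1 : ℝ) ≤ (k : ℝ) + 1 := by linarith
    have h7 := hφ.2 (Set.mem_Ici.mpr hk1') (Set.mem_Ici.mpr hk2)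
      (show 0 ≤ (k : ℝ) + 1 - r by linarith) (show 0 ≤ r - (k : ℝ) by linarith) (by ring)
    simp only [smul_eq_mul] at h7
    rw [show (k + 1 - r) * (k : ℝ) + (r - k) * (k + 1) = r by ring] at h7
    have h8 := mul_le_mul_of_nonneg_right h7 hK
    have h9 := mul_le_mul_of_nonneg_left h5 (show 0 ≤ (k : ℝ) + 1 - r by linarith)
    have h10 := mul_le_mul_of_nonneg_left h6 (show 0 ≤ r - (k : ℝ) by linarith)
    rw [← hsplit']
    nlinarith

namespace Matrix

variable {ι : Type} [Fintype ι] [DecidableEq ι]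

theorem permanent_eq_sum_prod (A : Matrix ι ι ℝ) :
    A.permanent = ∑ σ : Equiv.Perm ι, ∏ i, A i (σ i) := by
  rw [← permanent_transpose]; rfl

/-- The permanental cofactor of the entry `(i, k)`. -/
def permCofactor (A : Matrix ι ι ℝ) (i k : ι) : ℝ :=
  ∑ σ ∈ (Finset.univ : Finset (Equiv.Perm ι)).filter (fun σ => σ i = k),
    ∏ j ∈ Finset.univ.erase i, A j (σ j)

theorem permanent_eq_sum_mul_permCofactor (A : Matrix ι ι ℝ) (i : ι) :
    A.permanent = ∑ k, A i k * A.permCofactor i k := by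
  rw [permanent_eq_sum_prod, ← Finset.sum_fiberwise _ (fun σ : Equiv.Perm ι => σ i)]
  refine Finset.sum_congr rfl fun k _ => ?_
  rw [permCofactor, Finset.mul_sum]
  refine Finset.sum_congr rfl fun σ hσ => ?_
  rw [← Finset.mul_prod_erase Finset.univ _ (Finset.mem_univ i), (Finset.mem_filter.mp hσ).2]

theorem permCofactor_updateRow (A : Matrix ι ι ℝ) (i k : ι) (v : ι → ℝ) :
    (A.updateRow i v).permCofactor i k = A.permCofactor i k := by
  refine Finset.sum_congr rfl fun σ _ => Finset.prod_congr rfl fun j hj => ?_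
  rw [updateRow_ne (Finset.ne_of_mem_erase hj)]

theorem permanent_le_of_zero_one {φ : ℝ → ℝ}
    (hφ1 : ∀ k : ℕ, 1 ≤ k → φ k = Real.exp (logFactorialMean k))
    (A : Matrix ι ι ℝ) (hA : ∀ i j, A i j = 0 ∨ A i j = 1) (hsum : ∀ i, 1 ≤ ∑ j, A i j) :
    A.permanent ≤ ∏ i, φ (∑ j, A i j) := by
  classical
  set S : ι → Finset ι := fun i => Finset.univ.filter fun j => A i j = 1 with hS
  have hrow : ∀ i, ∑ j, A i j = (S i).card := fun i => by
    rw [Finset.card_filter]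
    push_cast
    refine Finset.sum_congr rfl fun j _ => ?_
    rcases hA i j with h | h <;> simp [h]
  have hper : A.permanent = (perfectMatchings S).card := by
    rw [permanent_eq_sum_prod, perfectMatchings, Finset.card_filter]
    push_cast
    refine Finset.sum_congr rfl fun σ _ => ?_
    split_ifs with h
    · exact Finset.prod_eq_one fun i _ => (Finset.mem_filter.mp (h i)).2
    · push Not at h
      obtain ⟨i, hi⟩ := h
      refine Finset.prod_eq_zero (Finset.mem_univ i) ((hA i (σ i)).resolve_right fun h1 => hi ?_)
      exact Finset.mem_filter.mpr ⟨Finset.mem_univ _, h1⟩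
  rw [hper]
  refine (card_perfectMatchings_le S).trans (le_of_eq (Finset.prod_congr rfl fun i _ => ?_))
  have := hsum i
  rw [hrow] at this
  rw [hrow, hφ1 _ (by exact_mod_cast this)]

/-- Bregman's bound extended to matrices with entries in `[0, 1]`. -/
theorem permanent_le_prod_of_concaveOn {φ : ℝ → ℝ} (hφ : ConcaveOn ℝ (Set.Ici 1) φ)
    (hφ0 : ∀ x, 1 ≤ x → 0 ≤ φ x)
    (hφ1 : ∀ k : ℕ, 1 ≤ k → φ k = Real.exp (logFactorialMean k))
    (A : Matrix ι ι ℝ) (h0 : ∀ i j, 0 ≤ A i j) (h1 : ∀ i j, A i j ≤ 1)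
    (hsum : ∀ i, 1 ≤ ∑ j, A i j) : A.permanent ≤ ∏ i, φ (∑ j, A i j) := by
  -- T holds the rows not yet known to be 0-1. The permanent is linear in row i with coefficients
  -- `permCofactor`, so bounds for all nonempty 0-1 choices of that row give the general one.
  suffices key : ∀ (T : Finset ι) (A : Matrix ι ι ℝ), (∀ i j, 0 ≤ A i j) → (∀ i j, A i j ≤ 1) →
      (∀ i, 1 ≤ ∑ j, A i j) → (∀ i ∉ T, ∀ j, A i j = 0 ∨ A i j = 1) →
      A.permanent ≤ ∏ i, φ (∑ j, A i j) from
    key Finset.univ A h0 h1 hsum fun i hi => absurd (Finset.mem_univ i) hi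
  intro T
  induction T using Finset.induction_on with
  | empty =>
    intro A _ _ hsum hA
    exact permanent_le_of_zero_one hφ1 A (fun i => hA i (Finset.notMem_empty i)) hsum
  | insert i T hi ih =>
    intro A h0 h1 hsum hA
    rw [permanent_eq_sum_mul_permCofactor A i,
      ← Finset.mul_prod_erase Finset.univ _ (Finset.mem_univ i)]
    refine sum_mul_le_of_concaveOn hφ (Finset.prod_nonneg fun j _ => hφ0 _ (hsum j)) (h0 i) (h1 i)
      (hsum i) fun U hU => ?_
    set v : ι → ℝ := fun j => if j ∈ U then 1 else 0 with hv
    have hvsum : ∑ j, v j = U.card := by simp [hv]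
    have hUpos : (1 : ℝ) ≤ U.card := by exact_mod_cast hU.card_pos
    have := ih (A.updateRow i v) ?_ ?_ ?_ ?_
    · rw [permanent_eq_sum_mul_permCofactor _ i,
        ← Finset.mul_prod_erase Finset.univ _ (Finset.mem_univ i)] at this
      simp only [updateRow_self, permCofactor_updateRow, hvsum] at this
      have hl : ∑ j, v j * A.permCofactor i j = ∑ j ∈ U, A.permCofactor i j := by
        simp [hv]
      rw [hl] at this
      refine this.trans (le_of_eq ?_)
      congr 1
      refine Finset.prod_congr rfl fun j hj => ?_
      rw [updateRow_ne (Finset.ne_of_mem_erase hj)]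
    all_goals intro j
    · by_cases hj : j = i
      · subst hj; intro k; rw [updateRow_self]; simp only [hv]; split_ifs <;> norm_num
      · rw [updateRow_ne hj]; exact h0 j
    · by_cases hj : j = i
      · subst hj; intro k; rw [updateRow_self]; simp only [hv]; split_ifs <;> norm_num
      · rw [updateRow_ne hj]; exact h1 j
    · by_cases hj : j = i
      · subst hj; rw [updateRow_self, hvsum]; exact hUpos
      · rw [updateRow_ne hj]; exact hsum j
    · intro hjT
      by_cases hj : j = i
      · subst hj; intro k; rw [updateRow_self]; simp only [hv]; split_ifs <;> simp
      · rw [updateRow_ne hj]; exact hA j (by simp [hj, hjT])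

end Matrix

/-! ### Convexity and derivative estimates for log Γ(x + 1). -/

section

open Filter Topology

/-- The logarithm of the real factorial `Γ (x + 1)`. -/
noncomputable def logFac (x : ℝ) : ℝ := Real.log (Real.Gamma (x + 1))

namespace logFac

theorem zero_eq : logFac 0 = 0 := by simp [logFac]

theorem natCast_eq (n : ℕ) : logFac n = Real.log n.factorial := by
  rw [logFac, Real.Gamma_nat_eq_factorial]

theorem one_eq : logFac 1 = 0 := by simpa using natCast_eq 1

theorem add_one {x : ℝ} (hx : -1 < x) : logFac (x + 1) = logFac x + Real.log (x + 1) := by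
  have h : 0 < x + 1 := by linarith
  rw [logFac, Real.Gamma_add_one h.ne', Real.log_mul h.ne' (Real.Gamma_pos_of_pos h).ne', add_comm,
    logFac]

theorem convexOn : ConvexOn ℝ (Set.Ioi (-1)) logFac := by
  refine ⟨convex_Ioi _, fun x hx y hy a b ha hb hab => ?_⟩
  have hx' : (0 : ℝ) < x + 1 := by linarith [Set.mem_Ioi.mp hx]
  have hy' : (0 : ℝ) < y + 1 := by linarith [Set.mem_Ioi.mp hy]
  have := Real.convexOn_log_Gamma.2 (Set.mem_Ioi.mpr hx') (Set.mem_Ioi.mpr hy') ha hb hab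
  simp only [smul_eq_mul, Function.comp_apply] at this ⊢
  rw [show a * (x + 1) + b * (y + 1) = a * x + b * y + 1 by linear_combination hab] at this
  exact this

theorem contDiffAt {x : ℝ} (hx : -1 < x) : ContDiffAt ℝ 2 logFac x := by
  have hx' : 0 < x + 1 := by linarith
  have h1 : AnalyticAt ℂ Complex.Gamma ((x + 1 : ℝ) : ℂ) := by
    have hd : DifferentiableOn ℂ Complex.Gamma {z | 0 < z.re} := fun z hz =>
      (Complex.differentiableAt_Gamma z fun m h => by
        have hz' : 0 < z.re := hz
        rw [h] at hz'
        simp at hz'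
        have : (0 : ℝ) ≤ m := Nat.cast_nonneg m
        linarith).differentiableWithinAt
    exact hd.analyticAt ((isOpen_lt continuous_const Complex.continuous_re).mem_nhds
      (by simpa using hx'))
  have h2 : ContDiffAt ℝ 2 Real.Gamma (x + 1) := h1.contDiffAt.real_of_complex
  have h3 : ContDiffAt ℝ 2 (fun y : ℝ => y + 1) x := by fun_prop
  have h4 : ContDiffAt ℝ 2 (fun y => Real.Gamma (y + 1)) x := ContDiffAt.comp (g := Real.Gamma) x h2 h3
  exact h4.log (Real.Gamma_pos_of_pos hx').ne'

theorem hasDerivAt {x : ℝ} (hx : -1 < x) : HasDerivAt logFac (deriv logFac x) x :=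
  ((contDiffAt hx).differentiableAt (by norm_num)).hasDerivAt

theorem hasDerivAt_deriv {x : ℝ} (hx : -1 < x) :
    HasDerivAt (deriv logFac) (deriv (deriv logFac) x) x := by
  have h : ContDiffAt ℝ 1 (deriv logFac) x := (contDiffAt hx).derivWithin (by norm_num)
  exact (h.differentiableAt (by norm_num)).hasDerivAt

theorem deriv_add_one {x : ℝ} (hx : -1 < x) :
    deriv logFac (x + 1) = deriv logFac x + 1 / (x + 1) := by
  have h1 : HasDerivAt (fun y => logFac (y + 1)) (deriv logFac (x + 1)) x :=
    (hasDerivAt (by linarith : -1 < x + 1)).comp_add_const x 1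
  have h2 : HasDerivAt (fun y => logFac y + Real.log (y + 1)) (deriv logFac x + 1 / (x + 1)) x :=
    (hasDerivAt hx).add (((hasDerivAt_id x).add_const 1).log (by simp; linarith))
  refine h1.unique (h2.congr_of_eventuallyEq ?_)
  filter_upwards [Ioi_mem_nhds hx] with y hy using add_one hy

theorem deriv2_add_one {x : ℝ} (hx : -1 < x) :
    deriv (deriv logFac) (x + 1) = deriv (deriv logFac) x - 1 / (x + 1) ^ 2 := by
  have hx' : x + 1 ≠ 0 := by linarith
  have h1 : HasDerivAt (fun y => deriv logFac (y + 1)) (deriv (deriv logFac) (x + 1)) x :=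
    (hasDerivAt_deriv (by linarith : -1 < x + 1)).comp_add_const x 1
  have h2 : HasDerivAt (fun y => deriv logFac y + 1 / (y + 1))
      (deriv (deriv logFac) x - 1 / (x + 1) ^ 2) x := by
    have h3 : HasDerivAt (fun y : ℝ => 1 / (y + 1)) (-1 / (x + 1) ^ 2) x := by
      simpa using ((hasDerivAt_id x).add_const 1).fun_inv hx'
    convert! (hasDerivAt_deriv hx).add h3 using 1
    ring
  refine h1.unique (h2.congr_of_eventuallyEq ?_)
  filter_upwards [Ioi_mem_nhds hx] with y hy using deriv_add_one hy

theorem deriv2_nonneg {x : ℝ} (hx : -1 < x) : 0 ≤ deriv (deriv logFac) x := by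
  have h := (convexOn.monotoneOn_deriv fun x hx =>
    (hasDerivAt hx).differentiableAt).derivWithin_nonneg (x := x)
  rwa [derivWithin_of_isOpen isOpen_Ioi hx] at h

/-- By convexity the derivative dominates the slope over [x−1, x], which is log x by the functional
equation. -/
theorem log_le_deriv {x : ℝ} (hx : 0 < x) : Real.log x ≤ deriv logFac x := by
  have h := convexOn.slope_le_of_hasDerivAt (x := x - 1) (y := x)
    (Set.mem_Ioi.mpr (by linarith)) (Set.mem_Ioi.mpr (by linarith)) (by linarith)
    (hasDerivAt (by linarith))
  have h2 := add_one (x := x - 1) (by linarith)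
  rw [sub_add_cancel] at h2
  rw [slope_def_field, h2] at h
  simpa using h

theorem deriv_le_log {x : ℝ} (hx : -1 < x) : deriv logFac x ≤ Real.log (x + 1) := by
  have h := convexOn.le_slope_of_hasDerivAt (x := x) (y := x + 1)
    (Set.mem_Ioi.mpr (by linarith)) (Set.mem_Ioi.mpr (by linarith)) (by linarith)
    (hasDerivAt (by linarith))
  rw [slope_def_field, add_one hx] at h
  simpa using h

end logFac

theorem concaveOn_mul_log_sub_log :
    ConcaveOn ℝ (Set.Ici 0) fun y : ℝ => y * (Real.log (y + 1) - Real.log y) := by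
  refine concaveOn_of_hasDerivWithinAt2_nonpos (convex_Ici 0)
    (f' := fun y => (Real.log (y + 1) - Real.log y) + y * (1 / (y + 1) - 1 / y))
    (f'' := fun y => 1 / (y + 1) - 1 / y + 1 / (y + 1) ^ 2) ?_ ?_ ?_ ?_
  · simp_rw [mul_sub]
    refine ContinuousOn.sub ?_ Real.continuous_mul_log.continuousOn
    refine continuousOn_id.mul (ContinuousOn.log (by fun_prop) fun y hy => ?_)
    have : (0 : ℝ) ≤ y := hy
    positivity
  all_goals
    intro y hy
    rw [interior_Ici, Set.mem_Ioi] at hy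
  · refine HasDerivAt.hasDerivWithinAt ?_
    have h1 : HasDerivAt (fun y : ℝ => Real.log (y + 1)) (1 / (y + 1)) y :=
      ((hasDerivAt_id y).add_const 1).log (by simp; positivity)
    have h2 : HasDerivAt Real.log (1 / y) y := by simpa using Real.hasDerivAt_log hy.ne'
    convert! (hasDerivAt_id y).mul (h1.sub h2) using 1
    simp
  · refine HasDerivAt.hasDerivWithinAt ?_
    have h1 : HasDerivAt (fun y : ℝ => Real.log (y + 1)) (1 / (y + 1)) y :=
      ((hasDerivAt_id y).add_const 1).log (by simp; positivity)
    have h2 : HasDerivAt Real.log (1 / y) y := by simpa using Real.hasDerivAt_log hy.ne'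
    have h3 : HasDerivAt (fun y : ℝ => 1 / (y + 1)) (-1 / (y + 1) ^ 2) y := by
      simpa using ((hasDerivAt_id y).add_const 1).fun_inv (by simp; positivity)
    have h4 : HasDerivAt (fun y : ℝ => 1 / y) (-1 / y ^ 2) y := by
      simpa [neg_div] using hasDerivAt_inv hy.ne'
    convert! (h1.sub h2).add ((hasDerivAt_id y).mul (h3.sub h4)) using 1
    simp
    field_simp
    ring
  · have : 1 / (y + 1) - 1 / y + 1 / (y + 1) ^ 2 = - (1 / (y * (y + 1) ^ 2)) := by
      field_simp; ring
    rw [this]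
    exact neg_nonpos.mpr (by positivity)

namespace logFac

/-- The Bohr–Mollerup approximants inherit concavity from the telescoping sum of (x+m)(log(x+m+1) −
log(x+m)) over m ≤ n, plus −(x+n+1) log(x+n+1) and an affine term. Pointwise limits preserve it. -/
theorem concaveOn_sub_mul_log :
    ConcaveOn ℝ (Set.Ici 0) fun x => logFac x - x * Real.log x := by
  have hpart : ∀ n : ℕ, ConcaveOn ℝ (Set.Ici 0) fun x : ℝ =>
      -∑ m ∈ Finset.range n, Real.log (x + 1 + m) - x * Real.log x
        + (x + n) * Real.log (x + n) := by
    intro n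
    induction n with
    | zero => simpa using concaveOn_const (0 : ℝ) (convex_Ici (0 : ℝ))
    | succ n ih =>
      have h1 : ConcaveOn ℝ (Set.Ici 0) fun x : ℝ =>
          (x + n) * (Real.log (x + n + 1) - Real.log (x + n)) := by
        have := concaveOn_mul_log_sub_log.translate_left (n : ℝ)
        exact this.subset (fun x hx => by
          have : (0 : ℝ) ≤ x := hx
          simp only [Set.mem_preimage, Set.mem_Ici]; positivity) (convex_Ici 0)
      refine (ih.add h1).congr fun x _ => ?_
      simp only [Pi.add_apply]
      rw [Finset.sum_range_succ]
      push_cast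
      rw [show x + 1 + n = x + n + 1 by ring, show x + (n + 1) = x + n + 1 by ring]
      ring
  have hseq : ∀ n : ℕ, ConcaveOn ℝ (Set.Ici 0) fun x : ℝ =>
      Real.BohrMollerup.logGammaSeq (x + 1) n - x * Real.log x := by
    intro n
    have h1 : ConcaveOn ℝ (Set.Ici 0) fun x : ℝ =>
        -((x + (n + 1 : ℕ)) * Real.log (x + (n + 1 : ℕ))) := by
      have := (Real.convexOn_mul_log.neg).translate_left ((n + 1 : ℕ) : ℝ)
      exact this.subset (fun x hx => by
        have : (0 : ℝ) ≤ x := hx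
        simp only [Set.mem_preimage, Set.mem_Ici]; positivity) (convex_Ici 0)
    have h2 : ConcaveOn ℝ (Set.Ici 0) fun x : ℝ =>
        (x + 1) * Real.log n + Real.log n.factorial := by
      refine ⟨convex_Ici 0, fun x _ y _ a b _ _ hab => le_of_eq ?_⟩
      simp only [smul_eq_mul]
      linear_combination (Real.log n + Real.log n.factorial) * hab
    refine (((hpart (n + 1)).add h1).add h2).congr fun x _ => ?_
    simp only [Pi.add_apply, Real.BohrMollerup.logGammaSeq]
    ring
  have hlim : ∀ x ∈ Set.Ici (0 : ℝ), Tendsto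
      (fun n => Real.BohrMollerup.logGammaSeq (x + 1) n - x * Real.log x) atTop
      (𝓝 (logFac x - x * Real.log x)) := fun x hx =>
    (Real.BohrMollerup.tendsto_log_gamma (by have : (0 : ℝ) ≤ x := hx
                                             positivity)).sub_const _
  refine ⟨convex_Ici 0, fun x hx y hy a b ha hb hab => ?_⟩
  exact le_of_tendsto_of_tendsto' (((hlim x hx).const_smul a).add ((hlim y hy).const_smul b))
    (hlim _ ((convex_Ici 0) hx hy ha hb hab)) fun n => (hseq n).2 hx hy ha hb hab

theorem deriv2_le_inv {x : ℝ} (hx : 0 < x) : deriv (deriv logFac) x ≤ 1 / x := by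
  have hd : ∀ y ∈ Set.Ioi (0 : ℝ), HasDerivAt (fun x => logFac x - x * Real.log x)
      (deriv logFac y - (Real.log y + 1)) y := fun y hy =>
    (hasDerivAt (by linarith [Set.mem_Ioi.mp hy])).sub (Real.hasDerivAt_mul_log (ne_of_gt hy))
  have hanti := (concaveOn_sub_mul_log.subset Set.Ioi_subset_Ici_self
    (convex_Ioi 0)).antitoneOn_deriv fun y hy => (hd y hy).differentiableAt
  have h := hanti.derivWithin_nonpos (x := x)
  rw [derivWithin_of_isOpen isOpen_Ioi hx] at h
  have h2 : HasDerivAt (deriv fun x => logFac x - x * Real.log x)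
      (deriv (deriv logFac) x - 1 / x) x := by
    have h3 : HasDerivAt (fun y => deriv logFac y - (Real.log y + 1))
        (deriv (deriv logFac) x - 1 / x) x := by
      have h4 : HasDerivAt (fun y => Real.log y + 1) (1 / x) x := by
        simpa using (Real.hasDerivAt_log hx.ne').add_const 1
      exact (hasDerivAt_deriv (by linarith)).sub h4
    refine h3.congr_of_eventuallyEq ?_
    filter_upwards [Ioi_mem_nhds hx] with y hy using (hd y hy).deriv
  rw [h2.deriv] at h
  linarith

end logFac

/-- Turns an asymptotic comparison into an exact one: only the unit-step difference and decay at
infinity need checking. -/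
theorem nonpos_of_le_add_one_of_tendsto {f : ℝ → ℝ} {x : ℝ}
    (h : ∀ y, x ≤ y → f y ≤ f (y + 1))
    {g : ℕ → ℝ} (hg : ∀ᶠ n : ℕ in atTop, f (x + n) ≤ g n) (hlim : Tendsto g atTop (𝓝 0)) :
    f x ≤ 0 := by
  have hle : ∀ n : ℕ, f x ≤ f (x + n) := by
    intro n
    induction n with
    | zero => simp
    | succ n ih =>
      refine ih.trans ((h (x + n) (by simp)).trans (le_of_eq ?_))
      push_cast
      ring_nf
  refine ge_of_tendsto hlim ?_
  filter_upwards [hg] with n hn using (hle n).trans hn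

namespace logFac

theorem tendsto_inv_add (x : ℝ) : Tendsto (fun n : ℕ => 1 / (x + n)) atTop (𝓝 0) := by
  simp_rw [one_div]
  exact tendsto_inv_atTop_zero.comp (tendsto_atTop_add_const_left _ x tendsto_natCast_atTop_atTop)

/-- A truncation of the asymptotic series of ψ'(x+1), ψ the digamma function; its unit-step defect
is an explicit positive rational function. -/
theorem deriv2_le {x : ℝ} (hx : 0 < x) : deriv (deriv logFac) x ≤
    1 / (x + 1) + 1 / (2 * (x + 1) ^ 2) + 1 / (6 * (x + 1) ^ 3) := by
  have := nonpos_of_le_add_one_of_tendsto (x := x) (f := fun x => deriv (deriv logFac) x -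
    (1 / (x + 1) + 1 / (2 * (x + 1) ^ 2) + 1 / (6 * (x + 1) ^ 3))) (fun y hy => ?_)
    (g := fun n : ℕ => 1 / (x + n)) ?_ (tendsto_inv_add x)
  · linarith
  · have hy' : 0 < y := hx.trans_le hy
    rw [deriv2_add_one (by linarith)]
    have : 1 / (y + 1) + 1 / (2 * (y + 1) ^ 2) + 1 / (6 * (y + 1) ^ 3) -
        (1 / (y + 1 + 1) + 1 / (2 * (y + 1 + 1) ^ 2) + 1 / (6 * (y + 1 + 1) ^ 3))
        - 1 / (y + 1) ^ 2 = 1 / (6 * (y + 1) ^ 3 * (y + 2) ^ 3) := by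
      rw [show y + 1 + 1 = y + 2 by ring]
      field_simp
      ring
    have h2 : 0 < 1 / (6 * (y + 1) ^ 3 * (y + 2) ^ 3) := by positivity
    linarith
  · filter_upwards with n
    have hn : 0 < x + n := by positivity
    have h1 := deriv2_le_inv hn
    have : 0 ≤ 1 / (x + n + 1) + 1 / (2 * (x + n + 1) ^ 2) + 1 / (6 * (x + n + 1) ^ 3) := by
      positivity
    linarith

theorem le_deriv2 {x : ℝ} (hx : 0 < x) :
    1 / (x + 1) + 1 / (2 * (x + 1) ^ 2) ≤ deriv (deriv logFac) x := by
  have := nonpos_of_le_add_one_of_tendsto (x := x) (f := fun x =>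
    (1 / (x + 1) + 1 / (2 * (x + 1) ^ 2)) - deriv (deriv logFac) x) (fun y hy => ?_)
    (g := fun n : ℕ => 2 * (1 / (x + n))) ?_ (by simpa using (tendsto_inv_add x).const_mul 2)
  · linarith
  · have hy' : 0 < y := hx.trans_le hy
    rw [deriv2_add_one (by linarith)]
    have : 1 / (y + 1) + 1 / (2 * (y + 1) ^ 2) -
        (1 / (y + 1 + 1) + 1 / (2 * (y + 1 + 1) ^ 2))
        - 1 / (y + 1) ^ 2 = - (1 / (2 * (y + 1) ^ 2 * (y + 2) ^ 2)) := by
      rw [show y + 1 + 1 = y + 2 by ring]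
      field_simp
      ring
    have h2 : 0 < 1 / (2 * (y + 1) ^ 2 * (y + 2) ^ 2) := by positivity
    linarith
  · filter_upwards with n
    have hn : 0 < x + n := by positivity
    have h1 := deriv2_nonneg (x := x + n) (by linarith)
    have h2 : 1 / (x + n + 1) ≤ 1 / (x + n) := one_div_le_one_div_of_le hn (by linarith)
    have h3 : 1 / (2 * (x + n + 1) ^ 2) ≤ 1 / (x + n) :=
      one_div_le_one_div_of_le hn (by nlinarith)
    linarith

end logFac

end

/-! ### Concavity of x ↦ Γ(x + 1)^(1/x) on [1, ∞). -/

section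

open Filter Topology

namespace logFac

/-- The remainder `x - (x * logFac' x - logFac x)`, half of `log (2 * π * x) - 1` up to `O(1 / x)`. -/
noncomputable def remainder (x : ℝ) : ℝ := x - x * deriv logFac x + logFac x

theorem hasDerivAt_remainder {x : ℝ} (hx : -1 < x) :
    HasDerivAt remainder (1 - x * deriv (deriv logFac) x) x := by
  convert! ((hasDerivAt_id x).sub ((hasDerivAt_id x).mul (hasDerivAt_deriv hx))).add
    (hasDerivAt hx) using 1
  simp
  ring

theorem deriv_one_add_nat (n : ℕ) :
    deriv logFac (1 + n) = deriv logFac 1 + ∑ k ∈ Finset.range n, 1 / ((k : ℝ) + 2) := by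
  induction n with
  | zero => simp
  | succ n ih =>
    have h0 : (0 : ℝ) ≤ n := Nat.cast_nonneg n
    rw [Finset.sum_range_succ, ← add_assoc, ← ih]
    push_cast
    rw [← add_assoc, deriv_add_one (by linarith)]
    ring_nf

theorem remainder_one_le : remainder 1 ≤ 0.595 := by
  -- `remainder 1` is Euler's constant, estimated by H_32 − log 32. A power of two reduces the
  -- logarithm to log 2, and 16 would be too small for 0.595.
  have h1 := deriv_one_add_nat 31
  have h2 := log_le_deriv (x := 1 + (31 : ℕ)) (by positivity)
  have h3 : Real.log (1 + (31 : ℕ)) = 5 * Real.log 2 := by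
    rw [show (1 + (31 : ℕ) : ℝ) = 2 ^ 5 by norm_num, Real.log_pow]
    norm_num
  have h4 : ∑ k ∈ Finset.range 31, 1 / ((k : ℝ) + 2) ≤ 3.0586 := by
    norm_num [Finset.sum_range_succ]
  have h5 := Real.log_two_gt_d9
  rw [remainder, one_eq]
  rw [h3, h1] at h2
  linarith

theorem remainder_nonneg {x : ℝ} (hx : 1 ≤ x) : 0 ≤ remainder x := by
  have hmono : MonotoneOn remainder (Set.Ici 1) := by
    refine monotoneOn_of_hasDerivWithinAt_nonneg (convex_Ici 1)
      (f' := fun x => 1 - x * deriv (deriv logFac) x) (fun y hy => ?_) (fun y hy => ?_)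
      fun y hy => ?_
    · have : (1 : ℝ) ≤ y := hy
      exact (hasDerivAt_remainder (by linarith)).continuousAt.continuousWithinAt
    all_goals rw [interior_Ici, Set.mem_Ioi] at hy
    · exact (hasDerivAt_remainder (by linarith)).hasDerivWithinAt
    · have h1 := mul_le_mul_of_nonneg_left (deriv2_le_inv (x := y) (by linarith))
        (show 0 ≤ y by linarith)
      rw [mul_one_div_cancel (by linarith)] at h1
      linarith
  refine le_trans ?_ (hmono (Set.mem_Ici.mpr le_rfl) hx hx)
  have h1 := deriv_le_log (x := 1) (by norm_num)
  have h2 := Real.log_two_lt_d9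
  rw [remainder, one_eq]
  norm_num at h1 ⊢
  linarith

/-- A rational function of `x` whose root dominates `remainder x / x`. -/
noncomputable def ratioBound (x : ℝ) : ℝ :=
  1 / (2 * (x + 1)) + 1 / (3 * (x + 1) ^ 2) + 1 / (6 * (x + 1) ^ 3)

theorem ratioBound_pos {x : ℝ} (hx : 0 < x) : 0 < ratioBound x := by
  rw [ratioBound]; positivity

theorem hasDerivAt_ratioBound {x : ℝ} (hx : 0 < x) : HasDerivAt ratioBound
    (-1 / (2 * (x + 1) ^ 2) - 2 / (3 * (x + 1) ^ 3) - 1 / (2 * (x + 1) ^ 4)) x := by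
  have hx' : x + 1 ≠ 0 := by positivity
  have h0 : HasDerivAt (fun x : ℝ => x + 1) 1 x := (hasDerivAt_id x).add_const 1
  have h1 : HasDerivAt (fun x : ℝ => 1 / (2 * (x + 1))) (-1 / (2 * (x + 1) ^ 2)) x := by
    convert! (hasDerivAt_const x (1 : ℝ)).fun_div (h0.const_mul 2) (by positivity) using 1
    field_simp; ring
  have h2 : HasDerivAt (fun x : ℝ => 1 / (3 * (x + 1) ^ 2)) (-2 / (3 * (x + 1) ^ 3)) x := by
    convert! (hasDerivAt_const x (1 : ℝ)).fun_div ((h0.fun_pow 2).const_mul 3) (by positivity) using 1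
    field_simp; ring
  have h3 : HasDerivAt (fun x : ℝ => 1 / (6 * (x + 1) ^ 3)) (-1 / (2 * (x + 1) ^ 4)) x := by
    convert! (hasDerivAt_const x (1 : ℝ)).fun_div ((h0.fun_pow 3).const_mul 6) (by positivity) using 1
    field_simp; ring
  convert! (h1.add h2).add h3 using 1
  ring

theorem sqrt_ratioBound_le {x : ℝ} (hx : 1 ≤ x) :
    √(ratioBound x) ≤ ((x + 1) ^ 2 + 1) / (2 * (x + 1) ^ 2) := by
  have hx0 : 0 < x := by linarith
  refine Real.sqrt_le_iff.mpr ⟨by positivity, ?_⟩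
  have : (((x + 1) ^ 2 + 1) / (2 * (x + 1) ^ 2)) ^ 2 - ratioBound x =
      (3 * (x + 1) ^ 3 * (x - 1) + 2 * (x + 1) * x + 3) / (12 * (x + 1) ^ 4) := by
    rw [ratioBound]
    field_simp
    ring
  have h2 : 0 ≤ (3 * (x + 1) ^ 3 * (x - 1) + 2 * (x + 1) * x + 3) / (12 * (x + 1) ^ 4) := by
    have : 0 ≤ x - 1 := by linarith
    positivity
  linarith

/-- The two sides are compared at 1, where the margin is small, and then through their derivatives,
using `le_deriv2` for the remainder and `sqrt_ratioBound_le` for the square root. -/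
theorem remainder_le {x : ℝ} (hx : 1 ≤ x) : remainder x ≤ x * √(ratioBound x) := by
  have hderiv : ∀ y, 1 ≤ y → HasDerivAt (fun x => x * √(ratioBound x) - remainder x)
      (√(ratioBound y) + y * ((-1 / (2 * (y + 1) ^ 2) - 2 / (3 * (y + 1) ^ 3)
        - 1 / (2 * (y + 1) ^ 4)) / (2 * √(ratioBound y))) -
        (1 - y * deriv (deriv logFac) y)) y := fun y hy => by
    have hy0 : 0 < y := by linarith
    convert! ((hasDerivAt_id y).mul ((hasDerivAt_ratioBound hy0).sqrt (ratioBound_pos hy0).ne')).sub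
      (hasDerivAt_remainder (by linarith)) using 1
    simp
  have hmono : MonotoneOn (fun x => x * √(ratioBound x) - remainder x) (Set.Ici 1) := by
    refine monotoneOn_of_hasDerivWithinAt_nonneg (convex_Ici 1)
      (fun y hy => (hderiv y hy).continuousAt.continuousWithinAt)
      (fun y hy => (hderiv y (interior_subset hy)).hasDerivWithinAt) fun y hy => ?_
    have hy1 : 1 ≤ y := interior_subset hy
    have hy0 : 0 < y := by linarith
    have hq := Real.sqrt_pos.mpr (ratioBound_pos hy0)
    have hsq := Real.sq_sqrt (ratioBound_pos hy0).le
    have h1 : √(ratioBound y) + y * ((-1 / (2 * (y + 1) ^ 2) - 2 / (3 * (y + 1) ^ 3)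
        - 1 / (2 * (y + 1) ^ 4)) / (2 * √(ratioBound y))) =
        (y + 2) * ((y + 1) ^ 2 + 1) / (2 * (y + 1) ^ 4) / (2 * √(ratioBound y)) := by
      rw [eq_div_iff (by positivity)]
      have : (√(ratioBound y) + y * ((-1 / (2 * (y + 1) ^ 2) - 2 / (3 * (y + 1) ^ 3)
        - 1 / (2 * (y + 1) ^ 4)) / (2 * √(ratioBound y)))) * (2 * √(ratioBound y)) =
        2 * √(ratioBound y) ^ 2 + y * (-1 / (2 * (y + 1) ^ 2) - 2 / (3 * (y + 1) ^ 3)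
        - 1 / (2 * (y + 1) ^ 4)) := by
        field_simp
      rw [this, hsq, ratioBound]
      field_simp
      ring
    have h2 : (y + 2) / (2 * (y + 1) ^ 2) ≤
        (y + 2) * ((y + 1) ^ 2 + 1) / (2 * (y + 1) ^ 4) / (2 * √(ratioBound y)) := by
      rw [le_div_iff₀ (by positivity)]
      calc (y + 2) / (2 * (y + 1) ^ 2) * (2 * √(ratioBound y))
          ≤ (y + 2) / (2 * (y + 1) ^ 2) * (2 * (((y + 1) ^ 2 + 1) / (2 * (y + 1) ^ 2))) := by
            gcongr
            exact sqrt_ratioBound_le hy1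
        _ = _ := by field_simp
    have h3 := mul_le_mul_of_nonneg_left (le_deriv2 hy0) hy0.le
    have h4 : 1 - y * (1 / (y + 1) + 1 / (2 * (y + 1) ^ 2)) = (y + 2) / (2 * (y + 1) ^ 2) := by
      field_simp; ring
    rw [h1]
    linarith
  have h := hmono (Set.mem_Ici.mpr le_rfl) hx hx
  have h1 : (0.595 : ℝ) ≤ √(ratioBound 1) := by
    refine Real.le_sqrt_of_sq_le ?_
    rw [ratioBound]; norm_num
  have h2 := remainder_one_le
  simp only [one_mul] at h
  linarith

/-- `ratioBound x` is exactly 1 − x times the upper bound of `deriv2_le`, so `remainder_le` closes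
the inequality. -/
theorem sq_mul_deriv2_add_le {x : ℝ} (hx : 1 ≤ x) :
    remainder x ^ 2 / x + x ^ 2 * deriv (deriv logFac) x ≤ x := by
  have hx0 : 0 < x := by linarith
  have h1 : remainder x ^ 2 ≤ x ^ 2 * ratioBound x := by
    rw [← Real.sq_sqrt (ratioBound_pos hx0).le, ← mul_pow]
    exact pow_le_pow_left₀ (remainder_nonneg hx) (remainder_le hx) 2
  have h2 := mul_le_mul_of_nonneg_left (deriv2_le hx0) (sq_nonneg x)
  have h3 : remainder x ^ 2 / x ≤ x * ratioBound x := by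
    rw [div_le_iff₀ hx0]; linarith
  have h4 : x * ratioBound x +
      x ^ 2 * (1 / (x + 1) + 1 / (2 * (x + 1) ^ 2) + 1 / (6 * (x + 1) ^ 3)) = x := by
    rw [ratioBound]; field_simp; ring
  linarith

theorem concaveOn_exp_div : ConcaveOn ℝ (Set.Ici 1) fun x => Real.exp (logFac x / x) := by
  have hψ : ∀ y, 1 ≤ y → HasDerivAt (fun x => logFac x / x)
      ((y - remainder y) / y ^ 2) y := fun y hy => by
    have hy0 : y ≠ 0 := by linarith
    convert! (hasDerivAt (by linarith)).fun_div (hasDerivAt_id y) hy0 using 1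
    rw [remainder]
    simp
    ring
  have h1 : ∀ y, 1 ≤ y → HasDerivAt (fun x => Real.exp (logFac x / x))
      (Real.exp (logFac y / y) * ((y - remainder y) / y ^ 2)) y := fun y hy => (hψ y hy).exp
  -- With ρ the remainder, (L/x)' = (x − ρ)/x² and ρ' = 1 − x L''; the cross terms in ρ cancel,
  -- leaving ρ²/x + x² L'' − x.
  have h2 : ∀ y, 1 ≤ y → HasDerivAt
      (fun x => Real.exp (logFac x / x) * ((x - remainder x) / x ^ 2))
      (Real.exp (logFac y / y) / y ^ 3 * (remainder y ^ 2 / y + y ^ 2 * deriv (deriv logFac) y - y))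
      y := fun y hy => by
    have hy0 : y ≠ 0 := by linarith
    have h3 := ((hasDerivAt_id y).sub (hasDerivAt_remainder (by linarith : -1 < y))).fun_div
      ((hasDerivAt_id y).fun_pow 2) (by simpa using hy0)
    convert! (h1 y hy).mul h3 using 1
    simp
    field_simp
    ring
  refine concaveOn_of_hasDerivWithinAt2_nonpos (convex_Ici 1)
    (fun y hy => (h1 y hy).continuousAt.continuousWithinAt)
    (fun y hy => (h1 y (interior_subset hy)).hasDerivWithinAt)
    (fun y hy => (h2 y (interior_subset hy)).hasDerivWithinAt) fun y hy => ?_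
  have hy1 : 1 ≤ y := interior_subset hy
  have := sq_mul_deriv2_add_le hy1
  exact mul_nonpos_of_nonneg_of_nonpos (by positivity) (by linarith)

end logFac

end

/-! ### Stirling's upper bound at real arguments. -/

section

open Filter Topology

theorem Real.add_half_mul_log_one_add_inv_le {a : ℝ} (ha : 0 < a) :
    (a + 1 / 2) * Real.log (1 + a⁻¹) ≤ 1 + 1 / (12 * a * (a + 1)) := by
  set z : ℝ := 1 / (2 * a + 1) with hz
  have hz0 : 0 < z := by positivity
  have hz1 : z ^ 2 < 1 := by
    rw [sq_lt_one_iff₀ hz0.le, hz, div_lt_one (by positivity)]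
    linarith
  have h1 : HasSum (fun k : ℕ => 1 / (2 * (k : ℝ) + 1) * (z ^ 2) ^ k)
      ((a + 1 / 2) * Real.log (1 + a⁻¹)) := by
    refine ((Real.hasSum_log_one_add_inv ha).mul_left (a + 1 / 2)).congr_fun fun k => ?_
    have : (a + 1 / 2) * z = 1 / 2 := by rw [hz]; field_simp
    rw [← hz, pow_succ z (2 * k), pow_mul]
    linear_combination (-2 * (1 / (2 * (k : ℝ) + 1)) * (z ^ 2) ^ k) * this
  -- The coefficients 1/(2k+1) are replaced by 1/3 for k ≥ 1; the 2/3 restores the term k = 0.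
  have h2 : HasSum (fun k : ℕ => 1 / 3 * (z ^ 2) ^ k + if k = 0 then (2 / 3 : ℝ) else 0)
      (1 / 3 * (1 - z ^ 2)⁻¹ + 2 / 3) :=
    ((hasSum_geometric_of_lt_one (by positivity) hz1).mul_left _).add (hasSum_ite_eq 0 _)
  refine (hasSum_le (fun k => ?_) h1 h2).trans (le_of_eq ?_)
  · rcases Nat.eq_zero_or_pos k with rfl | hk
    · norm_num
    · have hk' : (1 : ℝ) ≤ k := by exact_mod_cast hk
      rw [if_neg hk.ne', add_zero]
      gcongr
      linarith
  · have : 1 - z ^ 2 = 4 * a * (a + 1) / (2 * a + 1) ^ 2 := by rw [hz]; field_simp; ring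
    rw [this]
    field_simp
    ring

namespace logFac

/-- Stirling's approximation of `logFac`. -/
noncomputable def stirling (x : ℝ) : ℝ :=
  Real.log (2 * Real.pi * x) / 2 + x * Real.log x - x + 1 / (12 * x)

theorem sub_stirling_le_add_one {y : ℝ} (hy : 0 < y) :
    logFac y - stirling y ≤ logFac (y + 1) - stirling (y + 1) := by
  have h := Real.add_half_mul_log_one_add_inv_le hy
  have h1 : Real.log (1 + y⁻¹) = Real.log (y + 1) - Real.log y := by
    rw [← Real.log_div (by positivity) hy.ne']
    congr 1
    field_simp
  have h2 : ∀ z : ℝ, 0 < z → Real.log (2 * Real.pi * z) = Real.log (2 * Real.pi) + Real.log z :=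
    fun z hz => Real.log_mul (by positivity) hz.ne'
  have h3 : 1 / (12 * y * (y + 1)) = 1 / (12 * y) - 1 / (12 * (y + 1)) := by field_simp; ring
  rw [add_one (by linarith), stirling, stirling, h2 _ hy, h2 _ (by positivity)]
  rw [h1, h3] at h
  linarith

/-- Convexity interpolates L between n and n+1, so that the factorial asymptotics control the real
argument with an error O(1/n). -/
theorem sub_stirling_le {n : ℕ} (hn : 1 ≤ n) {t : ℝ} (ht : 0 ≤ t) (ht1 : t ≤ 1) :
    logFac (t + n) - stirling (t + n) ≤
      Real.log (Stirling.stirlingSeq n) - Real.log (√Real.pi) + 2 / n := by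
  have hn0 : (0 : ℝ) < n := by exact_mod_cast hn
  have h1 : logFac (t + n) ≤ Real.log n.factorial + t * Real.log (n + 1) := by
    have := convexOn.2 (x := (n : ℝ)) (y := (n : ℝ) + 1) (by simp; linarith) (by simp; linarith)
      (show 0 ≤ 1 - t by linarith) ht (by ring)
    simp only [smul_eq_mul] at this
    rw [show (1 - t) * (n : ℝ) + t * (n + 1) = t + n by ring, add_one (by linarith), natCast_eq]
      at this
    linarith
  have h2 : Real.log (2 * Real.pi * n) ≤ Real.log (2 * Real.pi * (t + n)) := by
    apply Real.log_le_log (by positivity)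
    gcongr
    linarith
  have h3 : Real.log (n + 1) - Real.log (t + n) ≤ 1 / n := by
    rw [← Real.log_div (by positivity) (by positivity)]
    refine (Real.log_le_sub_one_of_pos (by positivity)).trans ?_
    rw [div_sub_one (by positivity)]
    exact div_le_div₀ (by norm_num) (by linarith) hn0 (by linarith)
  have h4 : t / (t + n) ≤ Real.log (t + n) - Real.log n := by
    rw [← Real.log_div (by positivity) (by positivity)]
    refine le_trans (le_of_eq ?_) (Real.one_sub_inv_le_log_of_pos (by positivity))
    field_simp
    ring
  have h5 : t - n * (t / (t + n)) ≤ 1 / n := by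
    have : t - n * (t / (t + n)) = t ^ 2 / (t + n) := by field_simp; ring
    rw [this]
    exact div_le_div₀ (by norm_num) (by nlinarith) hn0 (by linarith)
  have h6 := Stirling.log_stirlingSeq_formula n
  have h7 : Real.log (√Real.pi) = Real.log Real.pi / 2 := Real.log_sqrt Real.pi_pos.le
  have h8 : Real.log (2 * Real.pi * n) = Real.log (2 * n) + Real.log Real.pi := by
    rw [← Real.log_mul (by positivity) (by positivity)]
    ring_nf
  have h9 : Real.log (n / Real.exp 1) = Real.log n - 1 := by
    rw [Real.log_div (by positivity) (Real.exp_pos 1).ne', Real.log_exp]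
  have h10 : 0 ≤ 1 / (12 * (t + n)) := by positivity
  have h11 := mul_le_mul_of_nonneg_left h3 ht
  have h12 : t * (1 / n) ≤ 1 / n := mul_le_of_le_one_left (by positivity) ht1
  have h13 := mul_le_mul_of_nonneg_left h4 hn0.le
  have h14 : (2 : ℝ) / n = 1 / n + 1 / n := by ring
  rw [stirling, h6, h7, h9, h14]
  nlinarith

/-- Stirling's upper bound for the Gamma function at positive reals. -/
theorem le_stirling {x : ℝ} (hx : 0 < x) : logFac x ≤ stirling x := by
  have hfl := Nat.floor_le hx.le
  have hfl2 := Nat.lt_floor_add_one x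
  have hlim : Tendsto (fun n : ℕ => Real.log (Stirling.stirlingSeq n) - Real.log (√Real.pi) + 2 / n)
      atTop (𝓝 0) := by
    have h1 := (Stirling.tendsto_stirlingSeq_sqrt_pi.log (by positivity)).sub_const
      (Real.log (√Real.pi))
    have h2 : Tendsto (fun n : ℕ => (2 : ℝ) / n) atTop (𝓝 0) := tendsto_const_div_atTop_nhds_zero_nat 2
    simpa using h1.add h2
  have := nonpos_of_le_add_one_of_tendsto (x := x) (f := fun x => logFac x - stirling x)
    (fun y hy => sub_stirling_le_add_one (hx.trans_le hy))
    (g := fun n : ℕ => Real.log (Stirling.stirlingSeq (n + ⌊x⌋₊)) - Real.log (√Real.pi)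
      + 2 / (n + ⌊x⌋₊ : ℕ)) ?_ (hlim.comp (tendsto_add_atTop_nat ⌊x⌋₊))
  · linarith
  · filter_upwards [eventually_ge_atTop 1] with n hn
    have := sub_stirling_le (n := n + ⌊x⌋₊) (by omega) (t := x - ⌊x⌋₊) (by linarith) (by linarith)
    rwa [show x - ⌊x⌋₊ + ((n + ⌊x⌋₊ : ℕ) : ℝ) = x + n by push_cast; ring] at this

end logFac

end

/-! ### Assembling the upper bounds. -/

theorem logFac.sum_mul_le {ι : Type*} [Fintype ι] {s : ι → ℝ} (hs : ∀ i, 0 < s i) {γ : ℝ}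
    (hγ : 0 < γ) (hsum : ∑ i, s i ≤ γ) :
    ∑ i, (Real.log (s i) + s i * logFac (1 / s i)) ≤
      γ * logFac (Fintype.card ι / γ) - Fintype.card ι * Real.log (Fintype.card ι / γ) := by
  set H : ℝ → ℝ := fun x => logFac x - x * Real.log x with hH
  have hH0 : H 0 = 0 := by simp [hH, logFac.zero_eq]
  have hterm : ∀ i, Real.log (s i) + s i * logFac (1 / s i) = γ * (s i / γ * H (1 / s i)) := by
    intro i
    have := (hs i).ne'
    simp only [hH, one_div, Real.log_inv]
    field_simp
    ring
  -- The weights s_i/γ at 1/s_i are completed by the leftover mass placed at 0, where H vanishes;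
  -- the mean is N/γ whether or not ∑ s_i equals γ.
  have h := logFac.concaveOn_sub_mul_log.le_map_sum (t := (Finset.univ : Finset (Option ι)))
    (w := fun o => o.elim (1 - (∑ i, s i) / γ) fun i => s i / γ)
    (p := fun o => o.elim 0 fun i => 1 / s i) ?_ ?_ ?_
  · rw [Fintype.sum_option, Fintype.sum_option] at h
    simp only [Option.elim, smul_eq_mul, mul_zero, zero_add] at h
    change (1 - (∑ i, s i) / γ) * H 0 + ∑ i, s i / γ * H (1 / s i) ≤ H _ at h
    have h2 : ∑ i, s i / γ * (1 / s i) = Fintype.card ι / γ := by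
      rw [Finset.sum_congr rfl fun i _ => show s i / γ * (1 / s i) = 1 / γ by
        have := (hs i).ne'
        field_simp]
      simp [div_eq_mul_inv]
    rw [h2, hH0, mul_zero, zero_add] at h
    rw [Finset.sum_congr rfl fun i _ => hterm i, ← Finset.mul_sum]
    refine (mul_le_mul_of_nonneg_left h hγ.le).trans (le_of_eq ?_)
    simp only [hH]
    field_simp
  · rintro (_ | i) _
    · have : (∑ i, s i) / γ ≤ 1 := (div_le_one hγ).mpr hsum
      simp only [Option.elim]; linarith
    · exact div_nonneg (hs i).le hγ.le
  · rw [Fintype.sum_option]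
    simp only [Option.elim, ← Finset.sum_div]
    ring
  · rintro (_ | i) _
    · simp
    · exact (one_div_pos.mpr (hs i)).le

/-- The **Soules bound** for the permanent of a stochastic matrix with prescribed row maxima. -/
theorem Matrix.permanent_le_exp_sum {ι : Type} [Fintype ι] [DecidableEq ι] (B : Matrix ι ι ℝ)
    (h0 : ∀ i j, 0 ≤ B i j) (hrow : ∀ i, ∑ j, B i j = 1) {s : ι → ℝ} (hs : ∀ i, 0 < s i)
    (hs1 : ∀ i, s i ≤ 1) (hle : ∀ i j, B i j ≤ s i) :
    B.permanent ≤ Real.exp (∑ i, (Real.log (s i) + s i * logFac (1 / s i))) := by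
  -- Dividing by s_i puts the entries in [0, 1] and makes the row sums 1/s_i ≥ 1, the range where φ
  -- is concave.
  set A : Matrix ι ι ℝ := fun i j => B i j / s i with hA
  have hsum : ∀ i, ∑ j, A i j = 1 / s i := fun i => by
    simp only [hA]
    rw [← Finset.sum_div, hrow]
  have hper : B.permanent = (∏ i, s i) * A.permanent := by
    rw [permanent_eq_sum_prod, permanent_eq_sum_prod, Finset.mul_sum]
    refine Finset.sum_congr rfl fun σ _ => ?_
    rw [← Finset.prod_mul_distrib]
    exact Finset.prod_congr rfl fun i _ => (mul_div_cancel₀ _ (hs i).ne').symm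
  have hbound := permanent_le_prod_of_concaveOn logFac.concaveOn_exp_div
    (fun x _ => (Real.exp_pos _).le)
    (fun k _ => by rw [logFac.natCast_eq, logFactorialMean]) A
    (fun i j => div_nonneg (h0 i j) (hs i).le) (fun i j => (div_le_one (hs i)).mpr (hle i j))
    fun i => by rw [hsum, le_div_iff₀ (hs i), one_mul]; exact hs1 i
  rw [hper, Real.exp_sum]
  refine (mul_le_mul_of_nonneg_left hbound (Finset.prod_nonneg fun i _ => (hs i).le)).trans
    (le_of_eq ?_)
  rw [← Finset.prod_mul_distrib]
  refine Finset.prod_congr rfl fun i _ => ?_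
  rw [hsum, Real.exp_add, Real.exp_log (hs i)]
  congr 2
  field_simp

theorem div_pow_mul_Gamma_rpow_eq_exp {N : ℕ} (hN : 1 ≤ N) {γ : ℝ} (hγ : 0 < γ) :
    (γ / (N : ℝ)) ^ N * Real.Gamma (1 + (N : ℝ) / γ) ^ γ =
      Real.exp (γ * logFac (N / γ) - N * Real.log (N / γ)) := by
  have hN0 : (0 : ℝ) < N := by exact_mod_cast hN
  have h1 : (γ / (N : ℝ)) ^ N = Real.exp (-(N * Real.log (N / γ))) := by
    rw [← mul_neg, ← Real.log_inv, inv_div, Real.exp_nat_mul, Real.exp_log (by positivity)]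
  rw [h1, add_comm 1, Real.rpow_def_of_pos (Real.Gamma_pos_of_pos (by positivity)), ← Real.exp_add,
    logFac]
  ring_nf

theorem corollary4p3 (N : ℕ) (hN : 1 ≤ N) (B : Matrix (Fin N) (Fin N) ℝ)
    (hB : B ∈ doublyStochastic ℝ (Fin N))
    (s : Fin N → ℝ) (hs : ∀ i, IsGreatest (Set.range fun j => B i j) (s i))
    (γ : ℝ) (hγ : 1 ≤ γ) (hsum : ∑ i, s i ≤ γ) :
    (N.factorial : ℝ) / (N : ℝ) ^ N ≤ B.permanent ∧
    B.permanent ≤ (γ / (N : ℝ)) ^ N * Real.Gamma (1 + (N : ℝ) / γ) ^ γ ∧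
    (γ / (N : ℝ)) ^ N * Real.Gamma (1 + (N : ℝ) / γ) ^ γ ≤
      (N.factorial : ℝ) / (N : ℝ) ^ N * (2 * Real.pi * (N : ℝ)) ^ (γ / 2) *
        Real.exp (γ ^ 2 / (12 * (N : ℝ))) := by
  have hγ0 : 0 < γ := by linarith
  have hN0 : (0 : ℝ) < N := by exact_mod_cast hN
  have hle : ∀ i j, B i j ≤ s i := fun i j => (hs i).2 ⟨j, rfl⟩
  have hs0 : ∀ i, 0 < s i := fun i => by
    obtain ⟨j, -, hj⟩ := Finset.exists_ne_zero_of_sum_ne_zero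
      ((sum_row_of_mem_doublyStochastic hB i).trans_ne one_ne_zero)
    exact ((nonneg_of_mem_doublyStochastic hB).lt_of_ne' hj).trans_le (hle i j)
  have hs1 : ∀ i, s i ≤ 1 := fun i => by
    obtain ⟨j, hj⟩ := (hs i).1
    rw [← hj]
    exact le_one_of_mem_doublyStochastic hB
  refine ⟨B.le_permanent_of_mem_doublyStochastic hN hB, ?_, ?_⟩
  · rw [div_pow_mul_Gamma_rpow_eq_exp hN hγ0]
    refine (B.permanent_le_exp_sum (fun i j => nonneg_of_mem_doublyStochastic hB)
      (sum_row_of_mem_doublyStochastic hB) hs0 hs1 hle).trans (Real.exp_le_exp.mpr ?_)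
    simpa using logFac.sum_mul_le hs0 hγ0 hsum
  · have hfac : Real.exp (-N) ≤ (N.factorial : ℝ) / (N : ℝ) ^ N := by
      rw [← Real.le_log_iff_exp_le (by positivity), Real.log_div (by positivity) (by positivity),
        Real.log_pow]
      have h1 := Stirling.le_log_factorial_stirling (n := N) (by omega)
      have h2 : 0 ≤ Real.log N := Real.log_nonneg (by exact_mod_cast hN)
      have h3 : 0 ≤ Real.log (2 * Real.pi) := Real.log_nonneg (by linarith [Real.pi_gt_three])
      linarith
    have hstir := mul_le_mul_of_nonneg_left (logFac.le_stirling (x := N / γ) (by positivity)) hγ0.le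
    -- Here γ ≥ 1 is used: Stirling at N/γ produces 2πN/γ, which is weakened to 2πN.
    have hlog : Real.log (2 * Real.pi * (N / γ)) ≤ Real.log (2 * Real.pi * N) := by
      apply Real.log_le_log (by positivity)
      gcongr
      exact div_le_self hN0.le hγ
    have hexpand : γ * logFac.stirling (N / γ) =
        γ / 2 * Real.log (2 * Real.pi * (N / γ)) + N * Real.log (N / γ) - N
          + γ ^ 2 / (12 * N) := by
      rw [logFac.stirling]
      field_simp
    have hlog' := mul_le_mul_of_nonneg_left hlog (show 0 ≤ γ / 2 by positivity)
    rw [div_pow_mul_Gamma_rpow_eq_exp hN hγ0]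
    calc Real.exp (γ * logFac (N / γ) - N * Real.log (N / γ))
        ≤ Real.exp (-N + Real.log (2 * Real.pi * N) * (γ / 2) + γ ^ 2 / (12 * N)) :=
          Real.exp_le_exp.mpr (by linarith)
      _ = Real.exp (-N) * (2 * Real.pi * (N : ℝ)) ^ (γ / 2) *
          Real.exp (γ ^ 2 / (12 * (N : ℝ))) := by
          rw [Real.exp_add, Real.exp_add, Real.rpow_def_of_pos (by positivity)]
      _ ≤ _ := by gcongr
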